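/- Let $0<\alpha<2$, $\varepsilon>0$, $\Omega=(-\pi,\pi)$ and $H=L^2(\Omega)$ (real-valued). For $\varphi\in C_c^\infty(\Omega)$, extended by zero to $\mathbb R$, put $$(-\Delta)^{\alpha/2}\varphi(x)=C(1,\alpha)\,\mathrm{P.V.}\!\int_{\mathbb R}\frac{\varphi(x)-\varphi(y)}{|x-y|^{1+\alpha}}\,dy,\qquad C(1,\alpha)=\frac{\alpha}{2^{1-\alpha}\pi^{1/2}}\,\frac{\Gamma(\frac{1+\alpha}{2})}{\Gamma(1-\frac{\alpha}{2})}.$$ Let $A_\varepsilon=-\varepsilon\Delta+(-\Delta)^{\alpha/2}$ be the operator in $H$ with exterior condition $u=0$ on $\mathbb R\setminus\Omega$: $u\in D(A_\varepsilon)$ and $A_\varepsilon u=w$ if and only if $u\in H^1_0(\Omega)$, $w\in L^2(\Omega)$ and $\int_\Omega u\,(-\varepsilon\varphi''+(-\Delta)^{\alpha/2}\varphi)\,dx=\int_\Omega w\varphi\,dx$ for all $\varphi\in C_c^\infty(\Omega)$. Let $g\in L^2(\Omega)$ and let $f:\mathbb R\to\mathbb R$ be such that $u\mapsto f\circ u$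 maps $H$ into $H$ and is locally Lipschitz on $H$ (every point of $H$ has a neighbourhood on which the map is Lipschitz). Assume that for some $p\ge 2$ and some positive constants $c_1,c_2,c_3,c_4$ $$c_1|s|^p-c_2\le f(s)s\le c_3|s|^p+c_4\qquad\text{for all } s\in\mathbb R .$$ Consider the problem $$u_t-\varepsilon\Delta u+(-\Delta)^{\alpha/2}u+f(u)=g\ \text{ in }\Omega,\qquad u|_{\mathbb R\setminus\Omega}=0,\qquad u(0)=u_0 .\tag{1}$$ A solution of (1) on $[0,T]$ is a function $u\in C([0,T];H)$ with $u(0)=u_0$ such that for all $\varphi\in D(A_\varepsilon)$ and $t\in[0,T]$ $$\langle u(t),\varphi\rangle=\langle u_0,\varphi\rangle+\int_0^t\big(-\langle u(s),A_\varepsilon\varphi\rangle-\langle f(u(s)),\varphi\rangle+\langle g,\varphi\rangle\big)\,ds .$$ Then $-A_\varepsilon$ is the infinitesimal generator of a strongly continuous semigroup $(e^{-A_\varepsilon t})_{t\ge0}$ on $H$, and for every $u_0\in H$ there is a function $u\in C([0,\infty);H)$ which is a solution of (1) on $[0,T]$ for every $T>0$ and is given by the variation-of-constants formula $$u(t)=e^{-A_\varepsilon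 t}u_0-\int_0^te^{-A_\varepsilon(t-s)}\big(f(u(s))-g\big)\,ds,\qquad t\ge0.$$ It is unique: for every $T>0$, each $v\in C([0,T];H)$ that is a solution of (1) on $[0,T]$, or that satisfies the variation-of-constants formula on $[0,T]$, coincides with $u$ on $[0,T]$. -/

import Mathlib

open Set Filter Topology MeasureTheory
open scoped ContDiff

noncomputable section

namespace AnomalousDiffusion

/-- The interval `Ω = (-π, π)`. -/
def Ω : Set ℝ := Ioo (-Real.pi) Real.pi

/-- Lebesgue measure on `Ω`. -/
def μΩ : Measure ℝ := volume.restrict Ω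

/-- The real Hilbert space `H = L²(Ω)`. -/
abbrev H : Type := Lp ℝ 2 μΩ

/-- `φ ∈ C_c^∞(Ω)`, regarded as a function on `ℝ` (zero outside `Ω`). -/
structure IsTestFunction (φ : ℝ → ℝ) : Prop where
  smooth : ContDiff ℝ ∞ φ
  compactSupport : HasCompactSupport φ
  support_subset : tsupport φ ⊆ Ω

/-- The constant `C(1, α) = α / (2^(1-α) π^(1/2)) * Γ((1+α)/2) / Γ(1-α/2)`. -/
def fracConst (α : ℝ) : ℝ :=
  α / ((2 : ℝ) ^ (1 - α) * Real.pi ^ (1 / 2 : ℝ)) *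
    (Real.Gamma ((1 + α) / 2) / Real.Gamma (1 - α / 2))

/-- The fractional Laplacian `(-Δ)^(α/2)` on `ℝ`, applied to a function `φ` at the point `x`:
`C(1, α)` times the principal value of `∫ (φ x - φ y) / |x - y|^(1+α) dy`.
It is only used for `φ ∈ C_c^∞` and `0 < α < 2`, where the principal value exists. -/
def fracLaplacian (α : ℝ) (φ : ℝ → ℝ) (x : ℝ) : ℝ :=
  fracConst α * limUnder (𝓝[>] (0 : ℝ)) fun δ : ℝ =>
    ∫ y in {y : ℝ | δ ≤ |x - y|}, (φ x - φ y) / |x - y| ^ (1 + α)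

/-- `u ∈ H₀¹(Ω)` with weak derivative `u'`: the pair `(u, u')` is an `L²`-limit of pairs
`(φ, φ')` with `φ ∈ C_c^∞(Ω)`. -/
def IsH01WithDeriv (u u' : H) : Prop :=
  (u, u') ∈ closure {q : H × H | ∃ φ : ℝ → ℝ, IsTestFunction φ ∧
    (q.1 : ℝ → ℝ) =ᵐ[μΩ] φ ∧ (q.2 : ℝ → ℝ) =ᵐ[μΩ] deriv φ}

/-- The Sobolev space `H₀¹(Ω)` as a subset of `L²(Ω)`. -/
def H01 : Set H := {u | ∃ u' : H, IsH01WithDeriv u u'}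

/-- The graph of the operator `A_ε = -ε Δ + (-Δ)^(α/2)` of `L²(Ω)` with exterior condition
`u = 0` on `ℝ \ Ω`: `IsAeps ε α u w` says that `u` is in the domain of `A_ε` and `A_ε u = w`,
that is, `u ∈ H₀¹(Ω)`, `w ∈ L²(Ω)`, and `-ε Δ u + (-Δ)^(α/2) u = w` holds in the sense of
distributions on `Ω`, where `u` is extended by zero. -/
def IsAeps (ε α : ℝ) (u w : H) : Prop :=
  u ∈ H01 ∧ ∀ φ : ℝ → ℝ, IsTestFunction φ →
    ∫ x in Ω, u x * (-ε * iteratedDeriv 2 φ x + fracLaplacian α φ x) = ∫ x in Ω, w x * φ x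

/-- `S` (of which only the values at `t ≥ 0` matter) is a strongly continuous semigroup
of bounded operators on `H`. -/
structure IsC0Semigroup (S : ℝ → H →L[ℝ] H) : Prop where
  zero : S 0 = ContinuousLinearMap.id ℝ H
  add : ∀ s t : ℝ, 0 ≤ s → 0 ≤ t → S (s + t) = (S s).comp (S t)
  strongly_continuous : ∀ x : H, ContinuousOn (fun t => S t x) (Ici 0)

/-- `S t = e^{-A t}`: `S` is a `C₀`-semigroup whose infinitesimal generator is `-A`, where the
operator `A` is given by its graph. -/
def IsExpNeg (A : H → H → Prop) (S : ℝ → H →L[ℝ] H) : Prop :=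
  IsC0Semigroup S ∧ ∀ u w : H,
    A u w ↔ Tendsto (fun t : ℝ => t⁻¹ • (S t u - u)) (𝓝[>] 0) (𝓝 (-w))

/-- The map `u ↦ f ∘ u` of `L²(Ω)` into itself induced by a scalar function `f`. -/
def nemytskii (f : ℝ → ℝ) (hf : ∀ u : H, MemLp (fun x => f (u x)) 2 μΩ) (u : H) : H :=
  (hf u).toLp (fun x => f (u x))

/-- `c₁ |s|^p - c₂ ≤ f(s) s ≤ c₃ |s|^p + c₄` for all real `s`, with positive constants. -/
def GrowthCondition (f : ℝ → ℝ) (p : ℝ) : Prop :=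
  ∃ c₁ c₂ c₃ c₄ : ℝ, 0 < c₁ ∧ 0 < c₂ ∧ 0 < c₃ ∧ 0 < c₄ ∧
    ∀ s : ℝ, c₁ * |s| ^ p - c₂ ≤ f s * s ∧ f s * s ≤ c₃ * |s| ^ p + c₄

/-- `u ∈ C([0,T]; H)` is a (weak) solution on `[0,T]` of
`du/dt + A u + F(u) = g`, `u(0) = u₀`, for a symmetric operator `A` given by its graph:
for all `φ` in the domain of `A`, with `ψ = A φ`, the function `t ↦ ⟨u(t), φ⟩` is absolutely
continuous with derivative `-⟨u(t), ψ⟩ - ⟨F(u(t)), φ⟩ + ⟨g, φ⟩`. -/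
structure IsSolutionOn (A : H → H → Prop) (F : H → H) (g u₀ : H) (T : ℝ) (u : ℝ → H) :
    Prop where
  continuousOn : ContinuousOn u (Icc 0 T)
  initial : u 0 = u₀
  equation : ∀ φ ψ : H, A φ ψ → ∀ t ∈ Icc 0 T,
    inner ℝ (u t) φ = inner ℝ u₀ φ +
      ∫ s in (0 : ℝ)..t, (-inner ℝ (u s) ψ - inner ℝ (F (u s)) φ + inner ℝ g φ)

/-- The variation-of-constants formula at time `t`:
`u(t) = S(t) u₀ - ∫₀ᵗ S(t-s) (F(u(s)) - g) ds`. -/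
def VariationOfConstants (S : ℝ → H →L[ℝ] H) (F : H → H) (g u₀ : H) (u : ℝ → H) (t : ℝ) :
    Prop :=
  u t = S t u₀ - ∫ s in (0 : ℝ)..t, S (t - s) (F (u s) - g)

end AnomalousDiffusion

end

set_option linter.unusedSectionVars false

/-! The proof has three independent ingredients: `-A_ε` generates a contraction semigroup, `f` is
globally Lipschitz, and weak and mild solutions coincide.

For test functions the fractional Laplacian is an absolutely convergent integral of second
differences (`fracLaplacian_eq`). Translation invariance and Fubini turn its pairing with another
test function into the Gagliardo form (`integral_mul_fracIntegral`), which is symmetric, nonnegative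
and dominated by the squared `H¹` norm. Adding `ε⟨φ', ψ'⟩` gives a form comparable with the Sobolev
norm up to a multiple of `‖φ‖²`. By Lax–Milgram its Friedrichs extension is a nonnegative
self-adjoint operator (`IsEllipticForm.isPosSelfAdjoint`), and its graph is exactly `IsAeps`
(`isAeps_iff_friedrichs`). The Hille–Yosida construction, carried out with Yosida approximations,
then yields a semigroup of symmetric contractions (`IsPosSelfAdjoint.exists_semigroup`) with
generator exactly `-A_ε` (`generator_iff`).

The superposition operator is Lipschitz on some ball around `0` in `L²`. Since `c` times the
indicator of a small set has small norm however large `c` is, that one Lipschitz constant controls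
`f(a) - f(b)` for all `a` and `b` (`exists_lipschitzWith`). Hence the superposition operator is
globally Lipschitz, no blow-up can occur, and a fixed point in an exponentially weighted sup norm
gives the global mild solution (`exists_mild`); the same weight gives uniqueness (`mild_unique`).

Mild solutions are weak because the semigroup is symmetric and the double time integral may be
swapped (`weak_of_mild`). Conversely, the difference of two weak solutions of a linear problem has a
time integral `Z` with `Z' = -A Z` and `Z(0) = 0`, so `‖Z‖` does not grow (`eq_zero_of_weak`). Every
weak solution is therefore mild, and uniqueness of mild solutions covers both notions. -/

namespace AnomalousDiffusion

/-! ### Semigroups with bounded nonnegative generator -/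

section BoundedGenerator

variable {X : Type*} [NormedAddCommGroup X] [InnerProductSpace ℝ X] [CompleteSpace X]

/-- The uniformly continuous group `e^{-tB}` generated by a bounded operator. -/
noncomputable def expNeg (B : X →L[ℝ] X) (t : ℝ) : X →L[ℝ] X := NormedSpace.exp (t • (-B))

theorem expNeg_zero (B : X →L[ℝ] X) : expNeg B 0 = 1 := by
  simp [expNeg]

theorem expNeg_add (B : X →L[ℝ] X) (s t : ℝ) : expNeg B (s + t) = expNeg B s * expNeg B t := by
  let _ := NormedAlgebra.restrictScalars ℚ ℝ (X →L[ℝ] X)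
  unfold expNeg
  rw [add_smul]
  exact NormedSpace.exp_add_of_commute
    (((Commute.refl (-B)).smul_left s).smul_right t)

theorem commute_expNeg {B C : X →L[ℝ] X} (h : Commute B C) (t : ℝ) : Commute B (expNeg C t) :=
  ((h.neg_right).smul_right t).exp_right

theorem hasDerivAt_expNeg (B : X →L[ℝ] X) (t : ℝ) :
    HasDerivAt (expNeg B) (expNeg B t * (-B)) t :=
  hasDerivAt_exp_smul_const (-B) t

theorem hasDerivAt_expNeg_apply (B : X →L[ℝ] X) (t : ℝ) (x : X) :
    HasDerivAt (fun s => expNeg B s x) (-(expNeg B t (B x))) t := by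
  have := (hasDerivAt_expNeg B t).clm_apply (hasDerivAt_const t x)
  simpa using this

theorem hasDerivAt_expNeg_apply' (B : X →L[ℝ] X) (t : ℝ) (x : X) :
    HasDerivAt (fun s => expNeg B s x) (-(B (expNeg B t x))) t := by
  have h := hasDerivAt_expNeg_apply B t x
  have hc : B (expNeg B t x) = expNeg B t (B x) :=
    congrArg (fun T : X →L[ℝ] X => T x) (commute_expNeg (Commute.refl B) t).eq
  rwa [hc]

/-- The squared norm along the orbit has derivative `-2⟨B y, y⟩ ≤ 0`, with `y` the current point. -/
theorem norm_expNeg_apply_le {B : X →L[ℝ] X} (hB : ∀ x, 0 ≤ inner ℝ (B x) x) {t : ℝ} (ht : 0 ≤ t)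
    (x : X) : ‖expNeg B t x‖ ≤ ‖x‖ := by
  have hd : ∀ s, HasDerivAt (fun s => ‖expNeg B s x‖ ^ 2)
      (2 * inner ℝ (expNeg B s x) (-(B (expNeg B s x)))) s :=
    fun s => (hasDerivAt_expNeg_apply' B s x).norm_sq
  have hanti : Antitone (fun s => ‖expNeg B s x‖ ^ 2) := by
    refine antitone_of_deriv_nonpos (fun s => (hd s).differentiableAt) fun s => ?_
    rw [(hd s).deriv, inner_neg_right, real_inner_comm]
    nlinarith [hB (expNeg B s x)]
  have h := hanti ht
  simp only [expNeg_zero, one_apply_eq_self] at h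
  exact (sq_le_sq₀ (norm_nonneg _) (norm_nonneg _)).1 h

theorem inner_expNeg {B : X →L[ℝ] X} (hB : ∀ x y, inner ℝ (B x) y = inner ℝ x (B y)) (t : ℝ)
    (x y : X) : inner ℝ (expNeg B t x) y = inner ℝ x (expNeg B t y) := by
  have hs : IsSelfAdjoint B :=
    ContinuousLinearMap.isSelfAdjoint_iff_isSymmetric.2 fun x y => hB x y
  have h2 : IsSelfAdjoint (t • (-B)) := by
    rw [isSelfAdjoint_iff, star_smul, star_neg, hs.star_eq, star_trivial]
  have h3 : IsSelfAdjoint (expNeg B t) := by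
    rw [isSelfAdjoint_iff, expNeg, NormedSpace.star_exp, h2.star_eq]
  exact (ContinuousLinearMap.isSelfAdjoint_iff_isSymmetric.1 h3) x y

theorem norm_expNeg_sub_le {B : X →L[ℝ] X} (hB : ∀ x, 0 ≤ inner ℝ (B x) x) {s t : ℝ}
    (hs : 0 ≤ s) (hst : s ≤ t) (x : X) :
    ‖expNeg B t x - expNeg B s x‖ ≤ (t - s) * ‖B x‖ := by
  have := norm_image_sub_le_of_norm_deriv_le_segment' (f := fun r => expNeg B r x)
    (f' := fun r => -(expNeg B r (B x))) (C := ‖B x‖) (a := s) (b := t)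
    (fun r _ => (hasDerivAt_expNeg_apply B r x).hasDerivWithinAt)
    (fun r hr => by
      rw [norm_neg]; exact norm_expNeg_apply_le hB (hs.trans hr.1) _) t ⟨hst, le_rfl⟩
  rwa [mul_comm] at this

/-- The path `r ↦ e^{-rB} e^{-(t-r)C} x` joins the two orbits. Commutativity lets its derivative be
written as two contractions applied to `(C - B) x`. This makes the Yosida semigroups Cauchy. -/
theorem norm_expNeg_sub_expNeg_le {B C : X →L[ℝ] X} (hB : ∀ x, 0 ≤ inner ℝ (B x) x)
    (hC : ∀ x, 0 ≤ inner ℝ (C x) x) (hBC : Commute B C) {t : ℝ} (ht : 0 ≤ t) (x : X) :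
    ‖expNeg B t x - expNeg C t x‖ ≤ t * ‖B x - C x‖ := by
  have hd : ∀ r, HasDerivAt (fun r => expNeg B r (expNeg C (t - r) x))
      (expNeg B r (expNeg C (t - r) (C x - B x))) r := by
    intro r
    have h1 : HasDerivAt (fun r => expNeg C (t - r) x) (expNeg C (t - r) (C x)) r := by
      have := (hasDerivAt_expNeg_apply C (t - r) x).scomp r ((hasDerivAt_id r).const_sub t)
      simpa [Function.comp_def] using this
    have h2 := (hasDerivAt_expNeg B r).clm_apply h1
    refine h2.congr_deriv ?_
    have hc : B (expNeg C (t - r) x) = expNeg C (t - r) (B x) :=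
      congrArg (fun T : X →L[ℝ] X => T x) (commute_expNeg hBC (t - r)).eq
    simp only [map_sub, ← hc, mul_apply_eq_comp, neg_apply, map_neg]
    abel
  have := norm_image_sub_le_of_norm_deriv_le_segment'
    (f := fun r => expNeg B r (expNeg C (t - r) x))
    (f' := fun r => expNeg B r (expNeg C (t - r) (C x - B x))) (C := ‖B x - C x‖) (a := 0) (b := t)
    (fun r _ => (hd r).hasDerivWithinAt)
    (fun r hr => by
      rw [norm_sub_rev (B x)]
      exact (norm_expNeg_apply_le hB hr.1 _).trans
        (norm_expNeg_apply_le hC (by linarith [hr.2]) _)) t ⟨ht, le_rfl⟩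
  simpa [expNeg_zero, mul_comm] using this

end BoundedGenerator

/-! ### Strong convergence and continuity for families of contractions -/

section Contractions

variable {X : Type*} [NormedAddCommGroup X] [NormedSpace ℝ X]

theorem cauchySeq_of_dense {T : ℕ → X →L[ℝ] X} (hT : ∀ n x, ‖T n x‖ ≤ ‖x‖) {D : Set X}
    (hD : Dense D) (h : ∀ x ∈ D, CauchySeq fun n => T n x) (x : X) :
    CauchySeq fun n => T n x := by
  rw [Metric.cauchySeq_iff']
  intro ε hε
  obtain ⟨y, hy, hxy⟩ := Metric.dense_iff.1 hD x (ε / 3) (by positivity)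
  rw [Metric.mem_ball, dist_eq_norm] at hy
  obtain ⟨N, hN⟩ := Metric.cauchySeq_iff'.1 (h y hxy) (ε / 3) (by positivity)
  refine ⟨N, fun n hn => ?_⟩
  have h1 := hN n hn
  rw [dist_eq_norm] at h1 ⊢
  have e : T n x - T N x = T N (y - x) + (T n y - T N y) - T n (y - x) := by
    simp only [map_sub]; abel
  rw [e]
  have h2 := hT n (y - x)
  have h3 := hT N (y - x)
  calc _ ≤ ‖T N (y - x)‖ + ‖T n y - T N y‖ + ‖T n (y - x)‖ :=
        (norm_sub_le _ _).trans (add_le_add_left (norm_add_le _ _) _)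
    _ < ε := by linarith

theorem tendsto_of_dense {T : ℕ → X →L[ℝ] X} (hT : ∀ n x, ‖T n x‖ ≤ ‖x‖) {D : Set X}
    (hD : Dense D) (h : ∀ x ∈ D, Tendsto (fun n => T n x) atTop (𝓝 x)) (x : X) :
    Tendsto (fun n => T n x) atTop (𝓝 x) := by
  rw [Metric.tendsto_atTop]
  intro ε hε
  obtain ⟨y, hy, hxy⟩ := Metric.dense_iff.1 hD x (ε / 3) (by positivity)
  rw [Metric.mem_ball, dist_eq_norm] at hy
  obtain ⟨N, hN⟩ := Metric.tendsto_atTop.1 (h y hxy) (ε / 3) (by positivity)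
  refine ⟨N, fun n hn => ?_⟩
  have h1 := hN n hn
  rw [dist_eq_norm] at h1 ⊢
  have e : T n x - x = (y - x) + (T n y - y) - T n (y - x) := by
    simp only [map_sub]; abel
  rw [e]
  have h2 := hT n (y - x)
  calc _ ≤ ‖y - x‖ + ‖T n y - y‖ + ‖T n (y - x)‖ :=
        (norm_sub_le _ _).trans (add_le_add_left (norm_add_le _ _) _)
    _ < ε := by linarith

theorem continuous_of_dense {α : Type*} [TopologicalSpace α] {T : α → X →L[ℝ] X}
    (hT : ∀ a x, ‖T a x‖ ≤ ‖x‖) {D : Set X} (hD : Dense D)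
    (h : ∀ x ∈ D, Continuous fun a => T a x) (x : X) : Continuous fun a => T a x := by
  rw [continuous_iff_continuousAt]
  intro a
  rw [Metric.continuousAt_iff']
  intro ε hε
  obtain ⟨y, hy, hxy⟩ := Metric.dense_iff.1 hD x (ε / 3) (by positivity)
  rw [Metric.mem_ball, dist_eq_norm] at hy
  filter_upwards [Metric.continuousAt_iff'.1 ((h y hxy).continuousAt (x := a)) (ε / 3)
    (by positivity)] with b h1
  rw [dist_eq_norm] at h1 ⊢
  have e : T b x - T a x = T a (y - x) + (T b y - T a y) - T b (y - x) := by
    simp only [map_sub]; abel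
  rw [e]
  have h2 := hT a (y - x)
  have h3 := hT b (y - x)
  calc _ ≤ ‖T a (y - x)‖ + ‖T b y - T a y‖ + ‖T b (y - x)‖ :=
        (norm_sub_le _ _).trans (add_le_add_left (norm_add_le _ _) _)
    _ < ε := by linarith

/-- Contractivity makes the family equicontinuous in the vector, so strong continuity upgrades to
joint continuity. This is what makes the Duhamel integrands continuous. -/
theorem continuous_uncurry_of_contraction {α : Type*} [TopologicalSpace α] {T : α → X →L[ℝ] X}
    (hT : ∀ a x, ‖T a x‖ ≤ ‖x‖) (h : ∀ x, Continuous fun a => T a x) :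
    Continuous fun q : α × X => T q.1 q.2 := by
  rw [continuous_iff_continuousAt]
  rintro ⟨a, x⟩
  rw [ContinuousAt, tendsto_iff_norm_sub_tendsto_zero]
  have h1 : Tendsto (fun q : α × X => ‖q.2 - x‖ + ‖T q.1 x - T a x‖) (𝓝 (a, x)) (𝓝 0) := by
    have : Continuous fun q : α × X => ‖q.2 - x‖ + ‖T q.1 x - T a x‖ := by
      have := (h x).comp (continuous_fst (X := α) (Y := X))
      simp only [Function.comp_def] at this
      fun_prop
    simpa using this.tendsto (a, x)
  refine squeeze_zero (fun _ => norm_nonneg _) (fun q => ?_) h1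
  have e : T q.1 q.2 - T a x = T q.1 (q.2 - x) + (T q.1 x - T a x) := by
    simp only [map_sub]; abel
  rw [e]
  exact (norm_add_le _ _).trans (add_le_add_left (hT _ _) _)

end Contractions

/-! ### Nonnegative self-adjoint operators and the semigroups they generate -/

section HilleYosida

variable {X : Type*} [NormedAddCommGroup X] [InnerProductSpace ℝ X]

/-- The relation `A` is the graph of a nonnegative self-adjoint operator. -/
structure IsPosSelfAdjoint (A : X → X → Prop) : Prop where
  add : ∀ {u w v z}, A u w → A v z → A (u + v) (w + z)
  smul : ∀ (c : ℝ) {u w}, A u w → A (c • u) (c • w)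
  symm : ∀ {u w v z}, A u w → A v z → inner ℝ w v = inner ℝ u z
  nonneg : ∀ {u w}, A u w → 0 ≤ inner ℝ w u
  single_valued : ∀ {w}, A 0 w → w = 0
  surjective : ∀ {l : ℝ}, 0 < l → ∀ x, ∃ u w, A u w ∧ l • u + w = x

namespace IsPosSelfAdjoint

variable {A : X → X → Prop}

theorem sub (hA : IsPosSelfAdjoint A) {u w v z : X} (h : A u w) (h' : A v z) :
    A (u - v) (w - z) := by
  have := hA.add h (hA.smul (-1) h')
  simpa [sub_eq_add_neg] using this

theorem eq_zero_of_smul_add_eq_zero (hA : IsPosSelfAdjoint A) {u w : X} {l : ℝ} (hl : 0 < l)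
    (h : A u w) (h0 : l • u + w = 0) : u = 0 := by
  have h1 : inner ℝ (l • u + w) u = 0 := by rw [h0, inner_zero_left]
  rw [inner_add_left, real_inner_smul_left, real_inner_self_eq_norm_sq] at h1
  have h2 := hA.nonneg h
  have h3 : l * ‖u‖ ^ 2 = 0 := le_antisymm (by linarith) (by positivity)
  simpa [hl.ne'] using h3

theorem eq_of_smul_add_eq (hA : IsPosSelfAdjoint A) {u w v z : X} {l : ℝ} (hl : 0 < l)
    (h : A u w) (h' : A v z) (he : l • u + w = l • v + z) : u = v := by
  refine sub_eq_zero.1 (hA.eq_zero_of_smul_add_eq_zero hl (hA.sub h h') ?_)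
  rw [smul_sub]
  have := sub_eq_zero.2 he
  rw [← this]; abel

theorem smul_norm_le (hA : IsPosSelfAdjoint A) {u w : X} (l : ℝ)
    (h : A u w) : l * ‖u‖ ≤ ‖l • u + w‖ := by
  have h1 : l * ‖u‖ ^ 2 ≤ inner ℝ (l • u + w) u := by
    rw [inner_add_left, real_inner_smul_left, real_inner_self_eq_norm_sq]
    linarith [hA.nonneg h]
  have h2 := real_inner_le_norm (l • u + w) u
  rcases (norm_nonneg u).eq_or_lt with h3 | h3
  · rw [← h3]; simp
  · exact le_of_mul_le_mul_right (by nlinarith) h3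

theorem exists_resolvent (hA : IsPosSelfAdjoint A) {l : ℝ} (hl : 0 < l) :
    ∃ R : X →L[ℝ] X, ∀ x, A (R x) (x - l • R x) := by
  choose R W hR hx using hA.surjective hl
  have hW : ∀ x, W x = x - l • R x := fun x => eq_sub_of_add_eq' (hx x)
  let R' : X →ₗ[ℝ] X :=
    { toFun := R
      map_add' := fun x y => by
        refine hA.eq_of_smul_add_eq hl (hR (x + y)) (hA.add (hR x) (hR y)) ?_
        rw [hx, smul_add]
        nth_rw 1 [← hx x, ← hx y]
        abel
      map_smul' := fun c x => by
        refine hA.eq_of_smul_add_eq hl (hR (c • x)) (hA.smul c (hR x)) ?_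
        rw [hx, RingHom.id_apply, smul_comm, ← smul_add, hx] }
  refine ⟨R'.mkContinuous l⁻¹ fun x => ?_, fun x => ?_⟩
  · have := hA.smul_norm_le l (hR x)
    rw [hx] at this
    rw [inv_mul_eq_div, le_div_iff₀ hl, mul_comm]
    exact this
  · have := hR x
    rw [hW] at this
    exact this

/-- The resolvent `(l + A)⁻¹`. -/
noncomputable def resolvent (hA : IsPosSelfAdjoint A) {l : ℝ} (hl : 0 < l) : X →L[ℝ] X :=
  (hA.exists_resolvent hl).choose

theorem resolvent_spec (hA : IsPosSelfAdjoint A) {l : ℝ} (hl : 0 < l) (x : X) :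
    A (hA.resolvent hl x) (x - l • hA.resolvent hl x) :=
  (hA.exists_resolvent hl).choose_spec x

theorem resolvent_eq (hA : IsPosSelfAdjoint A) {l : ℝ} (hl : 0 < l) {u w x : X} (h : A u w)
    (hx : l • u + w = x) : hA.resolvent hl x = u := by
  refine hA.eq_of_smul_add_eq hl (hA.resolvent_spec hl x) h ?_
  rw [hx]; abel

theorem smul_norm_resolvent_le (hA : IsPosSelfAdjoint A) {l : ℝ} (hl : 0 < l) (x : X) :
    l * ‖hA.resolvent hl x‖ ≤ ‖x‖ := by
  have := hA.smul_norm_le l (hA.resolvent_spec hl x)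
  rwa [add_sub_cancel] at this

theorem inner_resolvent (hA : IsPosSelfAdjoint A) {l : ℝ} (hl : 0 < l) (x y : X) :
    inner ℝ (hA.resolvent hl x) y = inner ℝ x (hA.resolvent hl y) := by
  have := hA.symm (hA.resolvent_spec hl x) (hA.resolvent_spec hl y)
  rw [inner_sub_left, inner_sub_right, real_inner_smul_left, real_inner_smul_right] at this
  linarith

theorem resolvent_sub_resolvent (hA : IsPosSelfAdjoint A) {l m : ℝ} (hl : 0 < l) (hm : 0 < m)
    (x : X) : hA.resolvent hl x - hA.resolvent hm x =
      (m - l) • hA.resolvent hl (hA.resolvent hm x) := by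
  set u := hA.resolvent hm x with hu
  have h := hA.add (hA.resolvent_spec hm x) (hA.smul (m - l) (hA.resolvent_spec hl u))
  rw [sub_eq_iff_eq_add']
  refine hA.resolvent_eq hl h ?_
  rw [← hu]
  module

/-- Writing the resolvent identity in both orders expresses the same difference through both
products; the factor `m - l` then cancels. -/
theorem commute_resolvent (hA : IsPosSelfAdjoint A) {l m : ℝ} (hl : 0 < l) (hm : 0 < m) :
    Commute (hA.resolvent hl) (hA.resolvent hm) := by
  rcases eq_or_ne m l with rfl | hne
  · exact Commute.refl _
  · ext x
    have h1 := hA.resolvent_sub_resolvent hl hm x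
    have h2 := hA.resolvent_sub_resolvent hm hl x
    rw [← neg_sub, h1, ← neg_smul, neg_sub] at h2
    exact smul_right_injective X (sub_ne_zero.2 hne.symm) h2

/-- Write a vector orthogonal to the domain as `u + A u` and pair it with `u`: then `‖u‖² + ⟨A u, u⟩
= 0`, so `u = 0`, and single-valuedness kills the rest. -/
theorem dense_domain (hA : IsPosSelfAdjoint A) [CompleteSpace X] :
    Dense {u : X | ∃ w, A u w} := by
  let D : Submodule ℝ X :=
    { carrier := {u | ∃ w, A u w}
      add_mem' := fun ⟨w, h⟩ ⟨z, h'⟩ => ⟨w + z, hA.add h h'⟩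
      zero_mem' := ⟨_, by
        have := hA.smul 0 (hA.resolvent_spec one_pos 0)
        rw [zero_smul] at this
        exact this⟩
      smul_mem' := fun c _ ⟨w, h⟩ => ⟨c • w, hA.smul c h⟩ }
  have : D.topologicalClosure = ⊤ := by
    rw [Submodule.topologicalClosure_eq_top_iff, Submodule.eq_bot_iff]
    intro x hx
    obtain ⟨u, w, h, rfl⟩ := hA.surjective one_pos x
    have h0 : inner ℝ u ((1 : ℝ) • u + w) = 0 := (Submodule.mem_orthogonal _ _).1 hx u ⟨w, h⟩
    rw [one_smul, inner_add_right, real_inner_self_eq_norm_sq, real_inner_comm] at h0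
    have h1 := hA.nonneg h
    have h2 : u = 0 := by
      have : ‖u‖ ^ 2 = 0 := le_antisymm (by linarith) (by positivity)
      simpa using this
    subst h2
    simp [hA.single_valued h]
  exact Submodule.dense_iff_topologicalClosure_eq_top.2 this

/-- The Yosida approximation `l A (l + A)⁻¹`. -/
noncomputable def yosida (hA : IsPosSelfAdjoint A) {l : ℝ} (hl : 0 < l) : X →L[ℝ] X :=
  l • (1 - l • hA.resolvent hl)

theorem yosida_apply (hA : IsPosSelfAdjoint A) {l : ℝ} (hl : 0 < l) (x : X) :
    hA.yosida hl x = l • (x - l • hA.resolvent hl x) := rfl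

/-- On the domain the approximation is `l (l + A)⁻¹` applied to `A u`. This gives both the bound by
`‖A u‖` uniform in `l` and the convergence to `A u`. -/
theorem yosida_apply_eq (hA : IsPosSelfAdjoint A) {l : ℝ} (hl : 0 < l) {u w : X} (h : A u w) :
    hA.yosida hl u = l • hA.resolvent hl w := by
  have h1 : hA.resolvent hl (l • u + w) = u := hA.resolvent_eq hl h rfl
  rw [map_add, map_smul] at h1
  rw [yosida_apply]
  congr 1
  nth_rw 1 [← h1]
  abel

theorem norm_yosida_le (hA : IsPosSelfAdjoint A) {l : ℝ} (hl : 0 < l) {u w : X} (h : A u w) :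
    ‖hA.yosida hl u‖ ≤ ‖w‖ := by
  rw [hA.yosida_apply_eq hl h, norm_smul, Real.norm_of_nonneg hl.le]
  exact hA.smul_norm_resolvent_le hl w

theorem yosida_nonneg (hA : IsPosSelfAdjoint A) {l : ℝ} (hl : 0 < l) (x : X) :
    0 ≤ inner ℝ (hA.yosida hl x) x := by
  have h := hA.nonneg (hA.resolvent_spec hl x)
  rw [yosida_apply, real_inner_smul_left]
  set w := x - l • hA.resolvent hl x with hw
  have hx : x = w + l • hA.resolvent hl x := by rw [hw]; abel
  -- With `w = A (l + A)⁻¹ x` one has `⟨w, x⟩ = ‖w‖² + l ⟨w, (l + A)⁻¹ x⟩`, both terms being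
  -- nonnegative.
  rw [show inner ℝ w x = inner ℝ w (w + l • hA.resolvent hl x) from congrArg _ hx]
  rw [inner_add_right, real_inner_smul_right, real_inner_self_eq_norm_sq]
  positivity

theorem inner_yosida (hA : IsPosSelfAdjoint A) {l : ℝ} (hl : 0 < l) (x y : X) :
    inner ℝ (hA.yosida hl x) y = inner ℝ x (hA.yosida hl y) := by
  simp only [yosida_apply, real_inner_smul_left, real_inner_smul_right, inner_sub_left,
    inner_sub_right, hA.inner_resolvent hl]

theorem commute_yosida (hA : IsPosSelfAdjoint A) {l m : ℝ} (hl : 0 < l) (hm : 0 < m) :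
    Commute (hA.yosida hl) (hA.yosida hm) := by
  have h := hA.commute_resolvent hl hm
  exact (((Commute.one_left _).sub_left
    (((Commute.one_right _).sub_right (h.smul_right m)).smul_left l)).smul_left l).smul_right m

theorem tendsto_smul_resolvent [CompleteSpace X] (hA : IsPosSelfAdjoint A) (x : X) :
    Tendsto (fun n : ℕ => ((n : ℝ) + 1) • hA.resolvent (l := (n : ℝ) + 1) (by positivity) x)
      atTop (𝓝 x) := by
  refine tendsto_of_dense
    (T := fun n : ℕ => ((n : ℝ) + 1) • hA.resolvent (l := (n : ℝ) + 1) (by positivity))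
    (fun n x => ?_) hA.dense_domain (fun u ⟨w, h⟩ => ?_) x
  · rw [smul_apply, norm_smul, Real.norm_of_nonneg (by positivity)]
    exact hA.smul_norm_resolvent_le _ x
  · rw [tendsto_iff_norm_sub_tendsto_zero]
    refine squeeze_zero (g := fun n : ℕ => ‖w‖ * (1 / ((n : ℝ) + 1))) (fun _ => norm_nonneg _)
      (fun n => ?_) (by simpa using tendsto_one_div_add_atTop_nhds_zero_nat.const_mul ‖w‖)
    have hn : (0 : ℝ) < n + 1 := by positivity
    have h1 := hA.smul_norm_resolvent_le hn w
    have h2 : hA.resolvent hn (((n : ℝ) + 1) • u + w) = u := hA.resolvent_eq hn h rfl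
    rw [map_add, map_smul] at h2
    -- For `u` in the domain the error is the resolvent of `A u`, of size `O(1/n)`; density and
    -- contractivity do the rest.
    have h3 : ((n : ℝ) + 1) • hA.resolvent hn u - u = -hA.resolvent hn w := by
      nth_rw 2 [← h2]; abel
    change ‖((n : ℝ) + 1) • hA.resolvent hn u - u‖ ≤ _
    rw [h3, norm_neg, mul_one_div, le_div_iff₀ hn, mul_comm]
    exact h1

end IsPosSelfAdjoint

/-- `S t = e^{-tA}` for `t ≥ 0`, extended constantly to negative times, where `A` is a nonnegative
self-adjoint operator. -/
structure IsContractionSemigroup (A : X → X → Prop) (S : ℝ → X →L[ℝ] X) : Prop where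
  zero : S 0 = ContinuousLinearMap.id ℝ X
  add : ∀ s t : ℝ, 0 ≤ s → 0 ≤ t → S (s + t) = (S s).comp (S t)
  continuous_apply : ∀ x, Continuous fun t => S t x
  norm_le : ∀ t x, ‖S t x‖ ≤ ‖x‖
  symm : ∀ t x y, inner ℝ (S t x) y = inner ℝ x (S t y)
  sub_eq_integral : ∀ {u w}, A u w → ∀ {t : ℝ}, 0 ≤ t → S t u - u = -∫ s in (0 : ℝ)..t, S s w

namespace IsPosSelfAdjoint

variable {A : X → X → Prop} [CompleteSpace X]

/-- The semigroups generated by the Yosida approximations. -/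
noncomputable def yosidaSemigroup (hA : IsPosSelfAdjoint A) (n : ℕ) (t : ℝ) : X →L[ℝ] X :=
  expNeg (hA.yosida (l := (n : ℝ) + 1) (by positivity)) t

theorem norm_yosidaSemigroup_le (hA : IsPosSelfAdjoint A) (n : ℕ) {t : ℝ} (ht : 0 ≤ t) (x : X) :
    ‖hA.yosidaSemigroup n t x‖ ≤ ‖x‖ :=
  norm_expNeg_apply_le (hA.yosida_nonneg _) ht x

theorem tendsto_yosida (hA : IsPosSelfAdjoint A) {u w : X} (h : A u w) :
    Tendsto (fun n : ℕ => hA.yosida (l := (n : ℝ) + 1) (by positivity) u) atTop (𝓝 w) := by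
  simpa only [hA.yosida_apply_eq _ h] using hA.tendsto_smul_resolvent w

theorem exists_tendsto_yosidaSemigroup (hA : IsPosSelfAdjoint A) {t : ℝ} (ht : 0 ≤ t) (x : X) :
    ∃ y, Tendsto (fun n => hA.yosidaSemigroup n t x) atTop (𝓝 y) := by
  refine cauchySeq_tendsto_of_complete
    (cauchySeq_of_dense (fun n x => hA.norm_yosidaSemigroup_le n ht x) hA.dense_domain
      (fun u ⟨w, h⟩ => ?_) x)
  rw [Metric.cauchySeq_iff']
  intro ε hε
  -- The denominator is `t + 1` rather than `t` so that `t = 0` needs no separate case.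
  obtain ⟨N, hN⟩ := Metric.cauchySeq_iff'.1 (hA.tendsto_yosida h).cauchySeq (ε / (t + 1))
    (by positivity)
  refine ⟨N, fun n hn => ?_⟩
  have h1 := hN n hn
  rw [dist_eq_norm] at h1 ⊢
  rw [lt_div_iff₀ (by positivity)] at h1
  have h2 := norm_expNeg_sub_expNeg_le (hA.yosida_nonneg (l := (n : ℝ) + 1) (by positivity))
    (hA.yosida_nonneg (l := (N : ℝ) + 1) (by positivity)) (hA.commute_yosida _ _) ht u
  refine h2.trans_lt (lt_of_le_of_lt ?_ h1)
  rw [mul_comm]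
  exact mul_le_mul_of_nonneg_left (by linarith) (norm_nonneg _)

/-- The Hille–Yosida theorem for nonnegative self-adjoint operators. -/
theorem exists_semigroup (hA : IsPosSelfAdjoint A) :
    ∃ S : ℝ → X →L[ℝ] X, IsContractionSemigroup A S := by
  -- Replacing `t` by `max t 0` gives limits for every real `t`, so continuity and contractivity
  -- hold on the whole line without side conditions.
  choose S hS using fun t : ℝ =>
    hA.exists_tendsto_yosidaSemigroup (le_max_right t 0)
  have hle : ∀ t x, ‖S t x‖ ≤ ‖x‖ := fun t x =>
    le_of_tendsto (hS t x).norm (Eventually.of_forall fun n =>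
      hA.norm_yosidaSemigroup_le n (le_max_right t 0) x)
  let S' : ℝ → X →L[ℝ] X := fun t => LinearMap.mkContinuous
    { toFun := S t
      map_add' := fun x y => tendsto_nhds_unique (hS t (x + y)) (by
        simpa only [map_add] using (hS t x).add (hS t y))
      map_smul' := fun c x => tendsto_nhds_unique (hS t (c • x)) (by
        simpa only [map_smul, RingHom.id_apply] using (hS t x).const_smul c) } 1
      (fun x => by simpa using hle t x)
  have hS' : ∀ t, 0 ≤ t → ∀ x, Tendsto (fun n => hA.yosidaSemigroup n t x) atTop (𝓝 (S' t x)) := by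
    intro t ht x
    have := hS t x
    rwa [max_eq_left ht] at this
  have hmax : ∀ t x, Tendsto (fun n => hA.yosidaSemigroup n (max t 0) x) atTop (𝓝 (S' t x)) := hS
  have hle' : ∀ t x, ‖S' t x‖ ≤ ‖x‖ := hle
  have hcont : ∀ x, Continuous fun t => S' t x := by
    refine continuous_of_dense hle' hA.dense_domain fun u ⟨w, h⟩ => ?_
    -- On the domain the approximating orbits are Lipschitz in time with constant `‖A u‖`
    -- independent of `n`, and this survives the limit.
    have key : ∀ s t, s ≤ t → ‖S' t u - S' s u‖ ≤ ‖w‖ * (max t 0 - max s 0) := by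
      intro s t hst
      refine le_of_tendsto ((hmax t u).sub (hmax s u)).norm (Eventually.of_forall fun n => ?_)
      refine (norm_expNeg_sub_le (hA.yosida_nonneg _) (le_max_right s 0)
        (max_le_max_right 0 hst) u).trans ?_
      rw [mul_comm]
      exact mul_le_mul_of_nonneg_right (hA.norm_yosida_le _ h)
        (sub_nonneg.2 (max_le_max_right 0 hst))
    refine (LipschitzWith.of_dist_le_mul (K := ‖w‖₊) fun t s => ?_).continuous
    have hmaxle : ∀ s t : ℝ, s ≤ t → max t 0 - max s 0 ≤ t - s := fun s t hst => by
      rcases le_total s 0 with h1 | h1 <;> rcases le_total t 0 with h2 | h2 <;>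
        simp [h1, h2] <;> linarith
    rw [dist_eq_norm, dist_eq_norm, coe_nnnorm, Real.norm_eq_abs]
    rcases le_total s t with hst | hst
    · rw [abs_of_nonneg (sub_nonneg.2 hst)]
      exact (key s t hst).trans (mul_le_mul_of_nonneg_left (hmaxle s t hst) (norm_nonneg _))
    · rw [abs_of_nonpos (sub_nonpos.2 hst), norm_sub_rev, neg_sub]
      exact (key t s hst).trans (mul_le_mul_of_nonneg_left (hmaxle t s hst) (norm_nonneg _))
  refine ⟨S', ?_, ?_, hcont, hle', ?_, ?_⟩
  · ext x
    refine tendsto_nhds_unique (hS' 0 le_rfl x) ?_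
    simp [yosidaSemigroup, expNeg_zero]
  · intro s t hs ht
    ext x
    refine tendsto_nhds_unique (hS' (s + t) (add_nonneg hs ht) x) ?_
    have h1 := hS' s hs (S' t x)
    have h2 := ((hS' t ht x).sub_const (S' t x))
    rw [sub_self] at h2
    -- The inner argument varies with `n` as well; contractivity allows it to be replaced by its
    -- limit.
    have h3 : Tendsto (fun n => hA.yosidaSemigroup n s (hA.yosidaSemigroup n t x - S' t x)) atTop
        (𝓝 0) :=
      squeeze_zero_norm (fun n => hA.norm_yosidaSemigroup_le n hs _) (by simpa using h2.norm)
    have h4 := h3.add h1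
    rw [zero_add] at h4
    refine h4.congr fun n => ?_
    rw [map_sub, sub_add_cancel, yosidaSemigroup, yosidaSemigroup, yosidaSemigroup, expNeg_add]
    rfl
  · intro t x y
    refine tendsto_nhds_unique ((hmax t x).inner tendsto_const_nhds)
      ((tendsto_const_nhds.inner (hmax t y)).congr fun n => ?_)
    exact (inner_expNeg (hA.inner_yosida _) _ x y).symm
  · intro u w h t ht
    have h1 : ∀ n, hA.yosidaSemigroup n t u - u = -∫ s in (0 : ℝ)..t,
        hA.yosidaSemigroup n s (hA.yosida (l := (n : ℝ) + 1) (by positivity) u) := by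
      intro n
      have hd := fun s => hasDerivAt_expNeg_apply
        (hA.yosida (l := (n : ℝ) + 1) (by positivity)) s u
      have hc : Continuous fun s => hA.yosidaSemigroup n s
          (hA.yosida (l := (n : ℝ) + 1) (by positivity) u) :=
        continuous_iff_continuousAt.2 fun s =>
          (hasDerivAt_expNeg_apply (hA.yosida (l := (n : ℝ) + 1) (by positivity)) s
            (hA.yosida (l := (n : ℝ) + 1) (by positivity) u)).continuousAt
      have := intervalIntegral.integral_eq_sub_of_hasDerivAt (a := 0) (b := t)
        (fun s _ => hd s) (hc.neg.intervalIntegrable _ _)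
      rw [intervalIntegral.integral_neg] at this
      simp only [expNeg_zero, one_apply_eq_self] at this
      exact this.symm
    refine tendsto_nhds_unique ((hS' t ht u).sub_const u) ?_
    simp only [h1]
    refine Tendsto.neg ?_
    refine intervalIntegral.tendsto_integral_filter_of_dominated_convergence (fun _ => ‖w‖)
      (Eventually.of_forall fun n => ?_) (Eventually.of_forall fun n => ?_)
      intervalIntegrable_const ?_
    · refine Continuous.aestronglyMeasurable ?_
      exact continuous_iff_continuousAt.2 fun s =>
          (hasDerivAt_expNeg_apply (hA.yosida (l := (n : ℝ) + 1) (by positivity)) s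
            (hA.yosida (l := (n : ℝ) + 1) (by positivity) u)).continuousAt
    · refine ae_of_all _ fun s hs => ?_
      rw [uIoc_of_le ht] at hs
      exact (hA.norm_yosidaSemigroup_le n hs.1.le _).trans (hA.norm_yosida_le _ h)
    · refine ae_of_all _ fun s hs => ?_
      rw [uIoc_of_le ht] at hs
      have h2 := (hA.tendsto_yosida h).sub_const w
      rw [sub_self] at h2
      have h3 : Tendsto (fun n => hA.yosidaSemigroup n s
          (hA.yosida (l := (n : ℝ) + 1) (by positivity) u - w)) atTop (𝓝 0) :=
        squeeze_zero_norm (fun n => hA.norm_yosidaSemigroup_le n hs.1.le _) (by simpa using h2.norm)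
      have h4 := h3.add (hS' s hs.1.le w)
      rw [zero_add] at h4
      refine h4.congr fun n => ?_
      rw [map_sub, sub_add_cancel]

end IsPosSelfAdjoint

namespace IsContractionSemigroup

variable {A : X → X → Prop} {S : ℝ → X →L[ℝ] X} [CompleteSpace X]

theorem tendsto_of_mem (hS : IsContractionSemigroup A S) {u w : X} (h : A u w) :
    Tendsto (fun t : ℝ => t⁻¹ • (S t u - u)) (𝓝[>] 0) (𝓝 (-w)) := by
  have hc := hS.continuous_apply w
  have hd : HasDerivAt (fun t => ∫ s in (0 : ℝ)..t, S s w) (S 0 w) 0 :=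
    intervalIntegral.integral_hasDerivAt_right (hc.intervalIntegrable _ _)
      (hc.stronglyMeasurableAtFilter _ _) hc.continuousAt
  rw [hS.zero] at hd
  have h1 := hd.neg.tendsto_slope_zero_right
  simp only [zero_add, Pi.neg_apply, intervalIntegral.integral_same, neg_zero, sub_zero,
    ContinuousLinearMap.id_apply] at h1
  refine h1.congr' ?_
  filter_upwards [self_mem_nhdsWithin] with t ht
  rw [hS.sub_eq_integral h (le_of_lt ht)]

/-- The generator of the semigroup is exactly `-A`. -/
theorem generator_iff (hA : IsPosSelfAdjoint A) (hS : IsContractionSemigroup A S) (u w : X) :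
    A u w ↔ Tendsto (fun t : ℝ => t⁻¹ • (S t u - u)) (𝓝[>] 0) (𝓝 (-w)) := by
  refine ⟨hS.tendsto_of_mem, fun h => ?_⟩
  -- Maximality: compare `u` with the `v` in the domain solving `v + A v = u + w`. The difference
  -- quotients of `u - v` converge to `u - v` itself, while contractivity makes their pairing with
  -- `u - v` nonpositive, so `u = v`.
  obtain ⟨v, z, hv, he⟩ := hA.surjective one_pos (u + w)
  rw [one_smul] at he
  have h1 := h.sub (hS.tendsto_of_mem hv)
  have h2 : Tendsto (fun t : ℝ => t⁻¹ * inner ℝ (S t (u - v) - (u - v)) (u - v)) (𝓝[>] 0)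
      (𝓝 (‖u - v‖ ^ 2)) := by
    have e : -w - -z = u - v := by
      have : w = v + z - u := by rw [he]; abel
      rw [this]; abel
    rw [e] at h1
    have h3 := h1.inner (𝕜 := ℝ) (tendsto_const_nhds (x := u - v))
    rw [real_inner_self_eq_norm_sq] at h3
    refine h3.congr fun t => ?_
    rw [← real_inner_smul_left, map_sub]
    refine congrArg (fun q : X => inner ℝ q (u - v)) ?_
    module
  have h3 : ‖u - v‖ ^ 2 ≤ 0 := by
    refine le_of_tendsto h2 ?_
    filter_upwards [self_mem_nhdsWithin] with t ht
    refine mul_nonpos_of_nonneg_of_nonpos (inv_nonneg.2 (le_of_lt ht)) ?_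
    rw [inner_sub_left, real_inner_self_eq_norm_sq]
    have := real_inner_le_norm (S t (u - v)) (u - v)
    have h4 := mul_le_mul_of_nonneg_right (hS.norm_le t (u - v)) (norm_nonneg (u - v))
    nlinarith
  have h4 : u - v = 0 := by
    have : ‖u - v‖ ^ 2 = 0 := le_antisymm h3 (by positivity)
    simpa using this
  have h5 : u = v := sub_eq_zero.1 h4
  subst h5
  have h6 : z = w := add_left_cancel he
  rwa [← h6]

end IsContractionSemigroup

end HilleYosida

/-! ### Mild and weak solutions of linear and semilinear evolution equations -/

section Semilinear

/-- Fubini on the triangle `0 < s < r < t`, encoded as an indicator on the square so that both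
iterated integrals have fixed limits. -/
theorem intervalIntegral_triangle_swap {q : ℝ → ℝ → ℝ} (hq : Continuous (Function.uncurry q))
    {t : ℝ} (ht : 0 ≤ t) :
    ∫ s in (0 : ℝ)..t, ∫ r in s..t, q r s = ∫ r in (0 : ℝ)..t, ∫ s in (0 : ℝ)..r, q r s := by
  have h1 : ∀ s ∈ Ioc 0 t, ∫ r in s..t, q r s =
      ∫ r in Ioc 0 t, ({p : ℝ × ℝ | p.2 < p.1}.indicator (Function.uncurry q)) (r, s) := by
    intro s hs
    have e : (fun r => ({p : ℝ × ℝ | p.2 < p.1}.indicator (Function.uncurry q)) (r, s)) =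
        (Ioi s).indicator fun r => q r s := by
      ext r; simp [indicator_apply]
    rw [e, setIntegral_indicator measurableSet_Ioi, intervalIntegral.integral_of_le hs.2]
    congr 2
    ext r
    simp only [mem_Ioc, mem_inter_iff, mem_Ioi]
    exact ⟨fun h => ⟨⟨hs.1.trans h.1, h.2⟩, h.1⟩, fun h => ⟨h.2, h.1.2⟩⟩
  have h2 : ∀ r ∈ Ioc 0 t, ∫ s in (0 : ℝ)..r, q r s =
      ∫ s in Ioc 0 t, ({p : ℝ × ℝ | p.2 < p.1}.indicator (Function.uncurry q)) (r, s) := by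
    intro r hr
    have e : (fun s => ({p : ℝ × ℝ | p.2 < p.1}.indicator (Function.uncurry q)) (r, s)) =
        (Iio r).indicator fun s => q r s := by
      ext s; simp [indicator_apply]
    rw [e, setIntegral_indicator measurableSet_Iio, intervalIntegral.integral_of_le hr.1.le,
      ← setIntegral_congr_set (Ioo_ae_eq_Ioc (a := 0) (b := r))]
    congr 2
    ext s
    simp only [mem_Ioc, mem_inter_iff, mem_Iio, mem_Ioo]
    exact ⟨fun h => ⟨⟨h.1, h.2.le.trans hr.2⟩, h.2⟩, fun h => ⟨h.1.1, h.2⟩⟩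
  rw [intervalIntegral.integral_of_le ht, intervalIntegral.integral_of_le ht,
    setIntegral_congr_fun measurableSet_Ioc h1, setIntegral_congr_fun measurableSet_Ioc h2]
  refine integral_integral_swap
    (f := fun s r => ({p : ℝ × ℝ | p.2 < p.1}.indicator (Function.uncurry q)) (r, s)) ?_
  rw [Measure.prod_restrict]
  have hc : Continuous fun p : ℝ × ℝ => q p.2 p.1 := hq.comp continuous_swap
  have hi : IntegrableOn (fun p : ℝ × ℝ => q p.2 p.1) (Ioc 0 t ×ˢ Ioc 0 t)
      ((volume : Measure ℝ).prod volume) :=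
    (hc.continuousOn.integrableOn_compact (isCompact_Icc.prod isCompact_Icc)).mono_set
      (prod_mono Ioc_subset_Icc_self Ioc_subset_Icc_self)
  have hm : MeasurableSet {p : ℝ × ℝ | p.1 < p.2} := measurableSet_lt measurable_fst measurable_snd
  refine (hi.indicator hm).congr (ae_of_all _ fun p => ?_)
  simp [indicator_apply, Function.uncurry]

theorem integral_exp_mul {K : ℝ} (hK : 0 < K) (t : ℝ) :
    ∫ s in (0 : ℝ)..t, Real.exp (K * s) = (Real.exp (K * t) - 1) / K := by
  rw [intervalIntegral.integral_comp_mul_left (fun s => Real.exp s) hK.ne', integral_exp]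
  simp [inv_mul_eq_div]

variable {X : Type*} [NormedAddCommGroup X] [InnerProductSpace ℝ X] [CompleteSpace X]
  {A : X → X → Prop} {S : ℝ → X →L[ℝ] X}

theorem inner_intervalIntegral {f : ℝ → X} (hf : Continuous f) (a b : ℝ) (φ : X) :
    inner ℝ (∫ s in a..b, f s) φ = ∫ s in a..b, inner ℝ (f s) φ := by
  have := (innerSL ℝ φ).intervalIntegral_comp_comm (hf.intervalIntegrable (μ := volume) a b)
  simp only [innerSL_apply_apply] at this
  simp only [real_inner_comm φ]
  exact this.symm

namespace IsContractionSemigroup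

theorem continuous_uncurry (hS : IsContractionSemigroup A S) :
    Continuous fun q : ℝ × X => S q.1 q.2 :=
  continuous_uncurry_of_contraction hS.norm_le hS.continuous_apply

theorem continuous_comp (hS : IsContractionSemigroup A S) {α : Type*} [TopologicalSpace α]
    {r : α → ℝ} {h : α → X} (hr : Continuous r) (hh : Continuous h) :
    Continuous fun a => S (r a) (h a) :=
  hS.continuous_uncurry.comp (hr.prodMk hh)

theorem continuous_duhamel (hS : IsContractionSemigroup A S) {h : ℝ → X} (hh : Continuous h) :
    Continuous fun t => ∫ s in (0 : ℝ)..t, S (t - s) (h s) := by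
  refine intervalIntegral.continuous_parametric_intervalIntegral_of_continuous
    (f := fun t s => S (t - s) (h s)) ?_ continuous_id
  exact hS.continuous_comp (r := fun p : ℝ × ℝ => p.1 - p.2) (h := fun p : ℝ × ℝ => h p.2)
    (by fun_prop) (by fun_prop)

/-- Only `φ` has to lie in the domain: symmetry moves the semigroup onto it, where the integrated
generator identity is available. -/
theorem inner_apply_eq (hS : IsContractionSemigroup A S) {φ ψ : X} (hφ : A φ ψ) {t : ℝ}
    (ht : 0 ≤ t) (x : X) :
    inner ℝ (S t x) φ = inner ℝ x φ - ∫ s in (0 : ℝ)..t, inner ℝ (S s x) ψ := by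
  have h1 := hS.sub_eq_integral hφ ht
  have h2 := inner_intervalIntegral (hS.continuous_apply ψ) 0 t x
  rw [hS.symm, sub_eq_iff_eq_add.1 h1, inner_add_right, inner_neg_right, real_inner_comm, h2]
  have : ∀ s, inner ℝ (S s ψ) x = inner ℝ (S s x) ψ := fun s => by
    rw [hS.symm, real_inner_comm]
  simp only [this]
  ring

theorem duhamel_weak (hS : IsContractionSemigroup A S) {h : ℝ → X} (hh : Continuous h)
    {φ ψ : X} (hφ : A φ ψ) {t : ℝ} (ht : 0 ≤ t) :
    inner ℝ (∫ s in (0 : ℝ)..t, S (t - s) (h s)) φ =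
      ∫ r in (0 : ℝ)..t, (-inner ℝ (∫ s in (0 : ℝ)..r, S (r - s) (h s)) ψ + inner ℝ (h r) φ) := by
  have hc : ∀ r : ℝ, Continuous fun s => S (r - s) (h s) := fun r =>
    hS.continuous_comp (by fun_prop) hh
  have hq : Continuous (Function.uncurry fun r s => inner ℝ (S (r - s) (h s)) ψ) := by
    have : Continuous fun p : ℝ × ℝ => S (p.1 - p.2) (h p.2) :=
      hS.continuous_comp (by fun_prop) (by fun_prop)
    exact this.inner continuous_const
  have h1 : ∀ s ∈ uIcc 0 t, inner ℝ (S (t - s) (h s)) φ =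
      inner ℝ (h s) φ - ∫ r in s..t, inner ℝ (S (r - s) (h s)) ψ := by
    intro s hs
    rw [uIcc_of_le ht] at hs
    rw [hS.inner_apply_eq hφ (by linarith [hs.2]),
      intervalIntegral.integral_comp_sub_right (fun r => inner ℝ (S r (h s)) ψ) s, sub_self]
  have c1 : Continuous fun s => inner ℝ (h s) φ := hh.inner continuous_const
  have c2 : Continuous fun s => inner ℝ (∫ r in (0 : ℝ)..s, S (s - r) (h r)) ψ :=
    (hS.continuous_duhamel hh).inner continuous_const
  have c4 : Continuous fun s => -inner ℝ (∫ r in (0 : ℝ)..s, S (s - r) (h r)) ψ := c2.neg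
  have c3 : IntervalIntegrable (fun s => ∫ r in s..t, inner ℝ (S (r - s) (h s)) ψ) volume 0 t := by
    refine ContinuousOn.intervalIntegrable ?_
    refine (c1.sub ((hc t).inner (continuous_const (y := φ)))).continuousOn.congr fun s hs => ?_
    rw [Pi.sub_apply, h1 s hs]
    ring
  rw [inner_intervalIntegral (hc t), intervalIntegral.integral_congr h1,
    intervalIntegral.integral_sub (c1.intervalIntegrable _ _) c3,
    intervalIntegral_triangle_swap hq ht,
    intervalIntegral.integral_add (c4.intervalIntegrable _ _) (c1.intervalIntegrable _ _),
    intervalIntegral.integral_neg]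
  simp only [inner_intervalIntegral (hc _)]
  ring

/-- The variation-of-constants formula yields weak solutions of the linear problem. -/
theorem weak_of_mild (hS : IsContractionSemigroup A S) {h : ℝ → X} (hh : Continuous h) (x : X)
    {φ ψ : X} (hφ : A φ ψ) {t : ℝ} (ht : 0 ≤ t) :
    inner ℝ (S t x + ∫ s in (0 : ℝ)..t, S (t - s) (h s)) φ = inner ℝ x φ +
      ∫ r in (0 : ℝ)..t, (-inner ℝ (S r x + ∫ s in (0 : ℝ)..r, S (r - s) (h s)) ψ
        + inner ℝ (h r) φ) := by
  have c0 : Continuous fun s => inner ℝ (S s x) ψ :=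
    (hS.continuous_apply x).inner continuous_const
  have c1 : Continuous fun s => inner ℝ (h s) φ := hh.inner continuous_const
  have c2 : Continuous fun s => inner ℝ (∫ r in (0 : ℝ)..s, S (s - r) (h r)) ψ :=
    (hS.continuous_duhamel hh).inner continuous_const
  have c3 : Continuous fun s => -inner ℝ (S s x) ψ := c0.neg
  have c4 : Continuous fun s => -inner ℝ (∫ r in (0 : ℝ)..s, S (s - r) (h r)) ψ + inner ℝ (h s) φ :=
    c2.neg.add c1
  have e : ∀ r, -inner ℝ (S r x + ∫ s in (0 : ℝ)..r, S (r - s) (h s)) ψ + inner ℝ (h r) φ =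
      -inner ℝ (S r x) ψ +
        (-inner ℝ (∫ s in (0 : ℝ)..r, S (r - s) (h s)) ψ + inner ℝ (h r) φ) := fun r => by
    rw [inner_add_left]; ring
  simp only [e]
  rw [inner_add_left, hS.inner_apply_eq hφ ht, hS.duhamel_weak hh hφ ht,
    intervalIntegral.integral_add (c3.intervalIntegrable _ _)
      (c4.intervalIntegrable _ _), intervalIntegral.integral_neg]
  ring

end IsContractionSemigroup

/-- The adjoint of `A` is contained in `A`. If `v + A v = Z + z`, then `Z - v` is orthogonal to the
range of `1 + A`, which is everything, and hence to itself. -/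
theorem IsPosSelfAdjoint.mem_of_inner_eq (hA : IsPosSelfAdjoint A) {Z z : X}
    (h : ∀ φ ψ, A φ ψ → inner ℝ z φ = inner ℝ Z ψ) : A Z z := by
  obtain ⟨v, w, hv, he⟩ := hA.surjective one_pos (Z + z)
  rw [one_smul] at he
  obtain ⟨φ, ψ, hφ, he'⟩ := hA.surjective one_pos (Z - v)
  rw [one_smul] at he'
  have h1 : inner ℝ (Z - v) (φ + ψ) = 0 := by
    have h2 := h φ ψ hφ
    have h3 := hA.symm hv hφ
    have h4 : inner ℝ (v + w) φ = inner ℝ (Z + z) φ := by rw [he]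
    simp only [inner_add_left, inner_add_right, inner_sub_left] at h4 ⊢
    linarith
  rw [he', inner_self_eq_zero, sub_eq_zero] at h1
  subst h1
  rwa [add_left_cancel he] at hv

/-- Uniqueness of weak solutions of the homogeneous problem. -/
theorem IsPosSelfAdjoint.eq_zero_of_weak (hA : IsPosSelfAdjoint A) {T : ℝ}
    {z : ℝ → X} (hz : Continuous z) (h : ∀ φ ψ, A φ ψ → ∀ t ∈ Icc 0 T,
      inner ℝ (z t) φ = -∫ s in (0 : ℝ)..t, inner ℝ (z s) ψ) : ∀ t ∈ Icc 0 T, z t = 0 := by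
  -- A weak solution need not take values in the domain, but its time integral does, with `A Z =
  -- -z`.
  set Z : ℝ → X := fun t => ∫ s in (0 : ℝ)..t, z s with hZ
  have hZd : ∀ t, HasDerivAt Z (z t) t := fun t => hz.integral_hasStrictDerivAt 0 t |>.hasDerivAt
  have hmem : ∀ t ∈ Icc 0 T, A (Z t) (-z t) := by
    intro t ht
    refine hA.mem_of_inner_eq fun φ ψ hφ => ?_
    rw [inner_neg_left, h φ ψ hφ t ht, neg_neg, hZ, inner_intervalIntegral hz]
  -- Here `(‖Z‖²)' = 2⟨Z, z⟩ = -2⟨Z, A Z⟩ ≤ 0`, and `Z 0 = 0`.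
  have hanti : AntitoneOn (fun t => ‖Z t‖ ^ 2) (Icc 0 T) := by
    refine antitoneOn_of_deriv_nonpos (convex_Icc 0 T)
      (fun t _ => (hZd t).norm_sq.continuousAt.continuousWithinAt)
      (fun t _ => (hZd t).norm_sq.differentiableAt.differentiableWithinAt) fun t ht => ?_
    rw [(hZd t).norm_sq.deriv]
    have := hA.nonneg (hmem t (interior_subset ht))
    rw [inner_neg_left, real_inner_comm] at this
    linarith
  intro t ht
  have h0 : Z t = 0 := by
    have h1 := hanti (left_mem_Icc.2 (ht.1.trans ht.2)) ht ht.1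
    have h2 : Z 0 = 0 := by simp [hZ]
    simp only [h2, norm_zero, ne_eq, OfNat.ofNat_ne_zero, not_false_eq_true, zero_pow] at h1
    have h3 : ‖Z t‖ ^ 2 = 0 := le_antisymm h1 (by positivity)
    simpa using h3
  have h1 := hmem t ht
  rw [h0] at h1
  simpa using hA.single_valued h1

/-- Weak solutions of the linear problem satisfy the variation-of-constants formula. -/
theorem IsContractionSemigroup.mild_of_weak (hA : IsPosSelfAdjoint A)
    (hS : IsContractionSemigroup A S) {T : ℝ} {v h : ℝ → X} (hv : Continuous v)
    (hh : Continuous h) (x : X)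
    (hw : ∀ φ ψ, A φ ψ → ∀ t ∈ Icc 0 T, inner ℝ (v t) φ = inner ℝ x φ +
      ∫ s in (0 : ℝ)..t, (-inner ℝ (v s) ψ + inner ℝ (h s) φ)) :
    ∀ t ∈ Icc 0 T, v t = S t x + ∫ s in (0 : ℝ)..t, S (t - s) (h s) := by
  set w : ℝ → X := fun t => S t x + ∫ s in (0 : ℝ)..t, S (t - s) (h s) with hwdef
  have hwc : Continuous w := (hS.continuous_apply x).add (hS.continuous_duhamel hh)
  intro t ht
  refine sub_eq_zero.1 (hA.eq_zero_of_weak (T := T) (hv.sub hwc) (fun φ ψ hφ t ht => ?_) t ht)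
  have h1 := hw φ ψ hφ t ht
  have h2 : inner ℝ (w t) φ = inner ℝ x φ +
      ∫ s in (0 : ℝ)..t, (-inner ℝ (w s) ψ + inner ℝ (h s) φ) := hS.weak_of_mild hh x hφ ht.1
  have c1 : Continuous fun s => -inner ℝ (v s) ψ + inner ℝ (h s) φ :=
    (hv.inner continuous_const).neg.add (hh.inner continuous_const)
  have c2 : Continuous fun s => -inner ℝ (w s) ψ + inner ℝ (h s) φ :=
    (hwc.inner continuous_const).neg.add (hh.inner continuous_const)
  rw [Pi.sub_apply, inner_sub_left, h1, h2, add_sub_add_left_eq_sub,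
    ← intervalIntegral.integral_sub (c1.intervalIntegrable _ _) (c2.intervalIntegrable _ _),
    ← intervalIntegral.integral_neg]
  refine intervalIntegral.integral_congr fun s _ => ?_
  simp only [Pi.sub_apply, inner_sub_left]
  ring

/-- Uniqueness of mild solutions of the semilinear problem. -/
theorem IsContractionSemigroup.mild_unique (hS : IsContractionSemigroup A S) {F : X → X}
    {L : NNReal} (hF : LipschitzWith L F) {g x : X} {T : ℝ} {u v : ℝ → X}
    (hu : ContinuousOn u (Icc 0 T)) (hv : ContinuousOn v (Icc 0 T))
    (hmu : ∀ t ∈ Icc 0 T, u t = S t x - ∫ s in (0 : ℝ)..t, S (t - s) (F (u s) - g))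
    (hmv : ∀ t ∈ Icc 0 T, v t = S t x - ∫ s in (0 : ℝ)..t, S (t - s) (F (v s) - g)) :
    EqOn u v (Icc 0 T) := by
  intro t₀ ht₀
  -- Any `K > L` would serve: weighting by `e^{-Kt}` turns the Duhamel estimate into one with
  -- constant `L / K < 1`. It is applied at a maximum point `τ` of the weighted difference, in place
  -- of Gronwall.
  set K : ℝ := L + 1 with hK
  have hK0 : 0 < K := by positivity
  have hd : ContinuousOn (fun t => Real.exp (-(K * t)) * ‖u t - v t‖) (Icc 0 T) := by
    have := (hu.sub hv).norm
    have h2 : ContinuousOn (fun t => Real.exp (-(K * t))) (Icc 0 T) := by fun_prop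
    exact h2.mul this
  obtain ⟨τ, hτ, hmax⟩ := isCompact_Icc.exists_isMaxOn ⟨t₀, ht₀⟩ hd
  set M := Real.exp (-(K * τ)) * ‖u τ - v τ‖ with hM
  have hbound : ∀ s ∈ Icc 0 T, ‖u s - v s‖ ≤ M * Real.exp (K * s) := fun s hs => by
    have h1 : Real.exp (-(K * s)) * ‖u s - v s‖ ≤ M := hmax hs
    rw [Real.exp_neg, inv_mul_eq_div, div_le_iff₀ (Real.exp_pos _)] at h1
    exact h1
  have hint : ∀ w : ℝ → X, ContinuousOn w (Icc 0 T) →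
      IntervalIntegrable (fun s => S (τ - s) (F (w s) - g)) volume 0 τ := fun w hw => by
    refine ContinuousOn.intervalIntegrable ?_
    rw [uIcc_of_le hτ.1]
    have h1 : ContinuousOn (fun s => F (w s) - g) (Icc 0 τ) :=
      ((hF.continuous.comp_continuousOn hw).sub continuousOn_const).mono (Icc_subset_Icc_right hτ.2)
    exact hS.continuous_uncurry.comp_continuousOn (ContinuousOn.prodMk (by fun_prop) h1)
  have h1 : ‖u τ - v τ‖ ≤ ∫ s in (0 : ℝ)..τ, L * M * Real.exp (K * s) := by
    have e : u τ - v τ = ∫ s in (0 : ℝ)..τ, S (τ - s) (F (v s) - F (u s)) := by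
      rw [hmu τ hτ, hmv τ hτ, sub_sub_sub_cancel_left,
        ← intervalIntegral.integral_sub (hint v hv) (hint u hu)]
      refine intervalIntegral.integral_congr fun s _ => ?_
      simp only [← map_sub]
      congr 1
      abel
    rw [e]
    refine intervalIntegral.norm_integral_le_of_norm_le hτ.1 (ae_of_all _ fun s hs => ?_)
      (Continuous.intervalIntegrable (by fun_prop) _ _)
    refine (hS.norm_le _ _).trans ?_
    have h2 := hF.norm_sub_le (v s) (u s)
    rw [norm_sub_rev (v s)] at h2
    rw [mul_assoc]
    exact h2.trans (mul_le_mul_of_nonneg_left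
      (hbound s ⟨hs.1.le, hs.2.trans hτ.2⟩) L.coe_nonneg)
  rw [intervalIntegral.integral_const_mul, integral_exp_mul hK0] at h1
  have hM0 : 0 ≤ M := by positivity
  have h2 : ‖u τ - v τ‖ = M * Real.exp (K * τ) := by
    rw [hM, Real.exp_neg]
    field_simp
  have hMz : M = 0 := by
    rw [h2, mul_div_assoc', le_div_iff₀ hK0] at h1
    have hp := Real.exp_pos (K * τ)
    have hLM : 0 ≤ (L : ℝ) * M := by positivity
    -- The estimate reads `(L + 1) M e^{Kτ} ≤ L M (e^{Kτ} - 1)`; hence `M e^{Kτ} ≤ -L M ≤ 0`.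
    have : M * Real.exp (K * τ) ≤ 0 := by rw [hK] at h1 hp ⊢; nlinarith
    exact le_antisymm (nonpos_of_mul_nonpos_left this hp) hM0
  have h3 := hbound t₀ ht₀
  rw [hMz, zero_mul] at h3
  exact sub_eq_zero.1 (norm_le_zero_iff.1 h3)

/-- Existence of global mild solutions of the semilinear problem. -/
theorem IsContractionSemigroup.exists_mild (hS : IsContractionSemigroup A S) {F : X → X}
    {L : NNReal} (hF : LipschitzWith L F) (g x : X) :
    ∃ u : ℝ → X, Continuous u ∧ ∀ t, 0 ≤ t →
      u t = S t x - ∫ s in (0 : ℝ)..t, S (t - s) (F (u s) - g) := by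
  set K : ℝ := L + 1 with hK
  have hK0 : 0 < K := by positivity
  -- The unknown is `v(t) = e^{-Kt} u(t)`. In this variable the nonlinearity keeps the Lipschitz
  -- constant `L`, and the Duhamel operator gains the kernel factor `e^{-K(t-s)}`, whose integral is
  -- at most `1 / K`.
  let G : (ℝ → X) → ℝ → X := fun v s => Real.exp (-(K * s)) • (F (Real.exp (K * s) • v s) - g)
  have hGc : ∀ {v : ℝ → X}, Continuous v → Continuous (G v) := fun {v} hv => by
    have h1 : Continuous fun s => Real.exp (K * s) • v s := by fun_prop
    exact Continuous.smul (by fun_prop) ((hF.continuous.comp h1).sub continuous_const)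
  have hGd : ∀ (v w : ℝ → X) (s : ℝ), ‖G v s - G w s‖ ≤ L * ‖v s - w s‖ := fun v w s => by
    have h1 := hF.norm_sub_le (Real.exp (K * s) • v s) (Real.exp (K * s) • w s)
    rw [← smul_sub, norm_smul, Real.norm_of_nonneg (Real.exp_pos _).le] at h1
    have e : G v s - G w s = Real.exp (-(K * s)) •
        (F (Real.exp (K * s) • v s) - F (Real.exp (K * s) • w s)) := by
      simp only [G, ← smul_sub, sub_sub_sub_cancel_right]
    rw [e, norm_smul, Real.norm_of_nonneg (Real.exp_pos _).le]
    calc _ ≤ Real.exp (-(K * s)) * (L * (Real.exp (K * s) * ‖v s - w s‖)) :=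
          mul_le_mul_of_nonneg_left h1 (Real.exp_pos _).le
      _ = L * ‖v s - w s‖ := by rw [Real.exp_neg]; field_simp
  have hG0 : ∀ s, 0 ≤ s → ‖G 0 s‖ ≤ ‖F 0 - g‖ := fun s hs => by
    simp only [G, Pi.zero_apply, smul_zero, norm_smul, Real.norm_of_nonneg (Real.exp_pos _).le]
    refine mul_le_of_le_one_left (norm_nonneg _) (Real.exp_le_one_iff.2 ?_)
    have := mul_nonneg hK0.le hs
    linarith
  let I : (ℝ → X) → ℝ → X := fun q t => ∫ s in (0 : ℝ)..t, Real.exp (-(K * (t - s))) • S (t - s) (q s)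
  have hIint : ∀ {q : ℝ → X}, Continuous q → ∀ t : ℝ,
      Continuous fun s => Real.exp (-(K * (t - s))) • S (t - s) (q s) := fun {q} hq t =>
    Continuous.smul (by fun_prop) (hS.continuous_comp (by fun_prop) hq)
  have hIc : ∀ {q : ℝ → X}, Continuous q → Continuous (I q) := fun {q} hq => by
    refine intervalIntegral.continuous_parametric_intervalIntegral_of_continuous
      (f := fun t s => Real.exp (-(K * (t - s))) • S (t - s) (q s)) ?_ continuous_id
    exact Continuous.smul (f := fun p : ℝ × ℝ => Real.exp (-(K * (p.1 - p.2)))) (by fun_prop)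
      (hS.continuous_comp (r := fun p : ℝ × ℝ => p.1 - p.2) (h := fun p : ℝ × ℝ => q p.2)
        (by fun_prop) (by fun_prop))
  have hIb : ∀ (q : ℝ → X) (C : ℝ), (∀ s, 0 ≤ s → ‖q s‖ ≤ C) → ∀ t, 0 ≤ t →
      ‖I q t‖ ≤ C / K := fun q C hq t ht => by
    have hC : 0 ≤ C := (norm_nonneg _).trans (hq 0 le_rfl)
    have h1 : ‖I q t‖ ≤ ∫ s in (0 : ℝ)..t, C * Real.exp (-(K * t)) * Real.exp (K * s) := by
      refine intervalIntegral.norm_integral_le_of_norm_le ht (ae_of_all _ fun s hs => ?_)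
        (Continuous.intervalIntegrable (by fun_prop) _ _)
      rw [norm_smul, Real.norm_of_nonneg (Real.exp_pos _).le, mul_assoc, ← Real.exp_add, mul_comm C]
      refine mul_le_mul (le_of_eq (congrArg Real.exp (by ring)))
        ((hS.norm_le _ _).trans (hq s hs.1.le)) (norm_nonneg _) (Real.exp_pos _).le
    refine h1.trans ?_
    rw [intervalIntegral.integral_const_mul, integral_exp_mul hK0, mul_div_assoc']
    refine div_le_div_of_nonneg_right ?_ hK0.le
    have : Real.exp (-(K * t)) * (Real.exp (K * t) - 1) ≤ 1 := by
      rw [mul_sub, ← Real.exp_add, neg_add_cancel, Real.exp_zero]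
      linarith [Real.exp_pos (-(K * t))]
    rw [mul_assoc]
    exact mul_le_of_le_one_right hC this
  -- Freezing the value for negative times keeps the map inside the bounded continuous functions on
  -- all of `ℝ`, a complete space.
  let Ψ : (ℝ → X) → ℝ → X := fun v t =>
    Real.exp (-(K * max t 0)) • S (max t 0) x - I (G v) (max t 0)
  have hΨc : ∀ {v : ℝ → X}, Continuous v → Continuous (Ψ v) := fun {v} hv =>
    (Continuous.smul (by fun_prop) ((hS.continuous_apply x).comp (by fun_prop))).sub
      ((hIc (hGc hv)).comp (by fun_prop))
  have hΨb : ∀ (v : BoundedContinuousFunction ℝ X) (t : ℝ),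
      ‖Ψ v t‖ ≤ ‖x‖ + (L * ‖v‖ + ‖F 0 - g‖) / K := fun v t => by
    have ht : 0 ≤ max t 0 := le_max_right t 0
    refine (norm_sub_le _ _).trans (add_le_add ?_ (hIb _ _ (fun s hs => ?_) _ ht))
    · rw [norm_smul, Real.norm_of_nonneg (Real.exp_pos _).le]
      refine (mul_le_of_le_one_left (norm_nonneg _) (Real.exp_le_one_iff.2 ?_)).trans
        (hS.norm_le _ _)
      have := mul_nonneg hK0.le ht
      linarith
    · have h1 := hGd v 0 s
      have h2 : ‖G v s‖ ≤ ‖G v s - G 0 s‖ + ‖G 0 s‖ := by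
        simpa using norm_add_le (G v s - G 0 s) (G 0 s)
      have h3 : (L : ℝ) * ‖v s - (0 : ℝ → X) s‖ ≤ L * ‖v‖ := by
        rw [Pi.zero_apply, sub_zero]
        exact mul_le_mul_of_nonneg_left (v.norm_coe_le_norm s) L.coe_nonneg
      linarith [hG0 s hs]
  let Φ : BoundedContinuousFunction ℝ X → BoundedContinuousFunction ℝ X := fun v =>
    BoundedContinuousFunction.ofNormedAddCommGroup (Ψ v) (hΨc v.continuous) _ (hΨb v)
  have hΦ : ContractingWith (L / (L + 1)) Φ := by
    refine ⟨?_, LipschitzWith.of_dist_le_mul fun v w => ?_⟩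
    · rw [div_lt_one (by positivity)]; exact lt_add_one L
    · rw [BoundedContinuousFunction.dist_le (by positivity)]
      intro t
      have e : Φ v t - Φ w t = -I (fun s => G v s - G w s) (max t 0) := by
        change Ψ v t - Ψ w t = _
        simp only [Ψ, I, map_sub, smul_sub]
        rw [intervalIntegral.integral_sub ((hIint (hGc v.continuous) _).intervalIntegrable _ _)
          ((hIint (hGc w.continuous) _).intervalIntegrable _ _)]
        abel
      rw [dist_eq_norm, e, norm_neg]
      have h1 := hIb (fun s => G v s - G w s) (L * dist v w) (fun s _ => (hGd v w s).trans
        (mul_le_mul_of_nonneg_left (by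
          rw [← dist_eq_norm]; exact BoundedContinuousFunction.dist_coe_le_dist s) L.coe_nonneg))
        (max t 0) (le_max_right t 0)
      rw [hK] at h1
      push_cast
      rwa [div_mul_eq_mul_div]
  set v := hΦ.fixedPoint Φ
  have hv : Φ v = v := hΦ.fixedPoint_isFixedPt
  refine ⟨fun t => Real.exp (K * t) • v t, Continuous.smul (by fun_prop) v.continuous,
    fun t ht => ?_⟩
  have h1 : v t = Ψ v t := by
    nth_rw 1 [← hv]; rfl
  have h2 : Ψ v t = Real.exp (-(K * t)) • S t x - I (G v) t := by
    simp only [Ψ, max_eq_left ht]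
  simp only
  nth_rw 1 [h1]
  rw [h2, smul_sub, smul_smul, ← Real.exp_add, add_neg_cancel, Real.exp_zero, one_smul]
  congr 1
  rw [← intervalIntegral.integral_smul]
  refine intervalIntegral.integral_congr fun s _ => ?_
  simp only [G, map_smul, smul_smul, ← Real.exp_add]
  rw [show K * t + (-(K * (t - s)) + -(K * s)) = 0 by ring, Real.exp_zero, one_smul]

end Semilinear

/-! ### Friedrichs extension of an elliptic form -/

section Friedrichs

variable {X : Type*} [NormedAddCommGroup X] [InnerProductSpace ℝ X] [CompleteSpace X]
  {𝓓 : Type*} [AddCommGroup 𝓓] [Module ℝ 𝓓]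

/-- Extension of a bounded family of functionals, parametrized by a dense set of vectors. -/
noncomputable def extendForm {V : Type*} [NormedAddCommGroup V] [InnerProductSpace ℝ V]
    (f : 𝓓 →ₗ[ℝ] V →L[ℝ] ℝ) (e : 𝓓 →ₗ[ℝ] V) : V →L[ℝ] V →L[ℝ] ℝ :=
  f.extendOfNorm e

theorem extendForm_apply {V : Type*} [NormedAddCommGroup V] [InnerProductSpace ℝ V]
    {f : 𝓓 →ₗ[ℝ] V →L[ℝ] ℝ} {e : 𝓓 →ₗ[ℝ] V} (he : DenseRange e) {C : ℝ}
    (hf : ∀ φ, ‖f φ‖ ≤ C * ‖e φ‖) (φ : 𝓓) : extendForm f e (e φ) = f φ :=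
  LinearMap.extendOfNorm_eq he ⟨C, hf⟩ φ

/-- The inner product of the images under a bounded operator. -/
noncomputable def pullbackInner {V : Type*} [NormedAddCommGroup V] [InnerProductSpace ℝ V]
    (P : V →L[ℝ] X) : V →L[ℝ] V →L[ℝ] ℝ :=
  LinearMap.mkContinuous₂ (((innerₗ X).compl₁₂ P.toLinearMap P.toLinearMap)) (‖P‖ * ‖P‖)
    fun v z => by
      calc _ ≤ ‖P v‖ * ‖P z‖ := norm_inner_le_norm _ _
        _ ≤ (‖P‖ * ‖v‖) * (‖P‖ * ‖z‖) :=
          mul_le_mul (P.le_opNorm v) (P.le_opNorm z) (norm_nonneg _) (by positivity)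
        _ = _ := by ring

/-- A symmetric operator `T` on a space of test functions `φ`, embedded in `X` by `J₁`, whose
quadratic form is comparable with the Sobolev norm `‖J₁ φ‖² + ‖J₂ φ‖²`. -/
structure IsEllipticForm (J₁ J₂ T : 𝓓 →ₗ[ℝ] X) (ε C : ℝ) : Prop where
  pos : 0 < ε
  symm : ∀ φ ψ, inner ℝ (T φ) (J₁ ψ) = inner ℝ (J₁ φ) (T ψ)
  lower : ∀ φ, ε * ‖J₂ φ‖ ^ 2 ≤ inner ℝ (T φ) (J₁ φ)
  upper : ∀ φ, inner ℝ (T φ) (J₁ φ) ≤ C * (‖J₁ φ‖ ^ 2 + ‖J₂ φ‖ ^ 2)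
  eq_zero : ∀ w, (∀ φ, inner ℝ w (J₁ φ) = 0) → w = 0

/-- The test functions with their derivatives, as pairs. -/
noncomputable def pairMap (J₁ J₂ : 𝓓 →ₗ[ℝ] X) : 𝓓 →ₗ[ℝ] WithLp 2 (X × X) :=
  (WithLp.linearEquiv 2 ℝ (X × X)).symm.toLinearMap ∘ₗ J₁.prod J₂

theorem norm_sq_pairMap (J₁ J₂ : 𝓓 →ₗ[ℝ] X) (φ : 𝓓) :
    ‖pairMap J₁ J₂ φ‖ ^ 2 = ‖J₁ φ‖ ^ 2 + ‖J₂ φ‖ ^ 2 :=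
  WithLp.prod_norm_sq_eq_of_L2 _

/-- The closure of the test functions in the Sobolev norm. -/
noncomputable def formDomain (J₁ J₂ : 𝓓 →ₗ[ℝ] X) : Submodule ℝ (WithLp 2 (X × X)) :=
  (LinearMap.range (pairMap J₁ J₂)).topologicalClosure

noncomputable instance (J₁ J₂ : 𝓓 →ₗ[ℝ] X) : CompleteSpace (formDomain J₁ J₂) :=
  (Submodule.isClosed_topologicalClosure _).completeSpace_coe

/-- The embedding of the test functions into the form domain. -/
noncomputable def toFormDomain (J₁ J₂ : 𝓓 →ₗ[ℝ] X) : 𝓓 →ₗ[ℝ] formDomain J₁ J₂ :=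
  (pairMap J₁ J₂).codRestrict _ fun φ => Submodule.le_topologicalClosure _ ⟨φ, rfl⟩

theorem norm_sq_toFormDomain (J₁ J₂ : 𝓓 →ₗ[ℝ] X) (φ : 𝓓) :
    ‖toFormDomain J₁ J₂ φ‖ ^ 2 = ‖J₁ φ‖ ^ 2 + ‖J₂ φ‖ ^ 2 :=
  norm_sq_pairMap J₁ J₂ φ

theorem denseRange_toFormDomain (J₁ J₂ : 𝓓 →ₗ[ℝ] X) : DenseRange (toFormDomain J₁ J₂) := by
  intro v
  rw [closure_subtype]
  have h : ((↑) : formDomain J₁ J₂ → WithLp 2 (X × X)) '' range (toFormDomain J₁ J₂) =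
      range (pairMap J₁ J₂) := by
    rw [← range_comp]; rfl
  rw [h]
  exact v.2

/-- The first component of an element of the form domain. -/
noncomputable def formFst (J₁ J₂ : 𝓓 →ₗ[ℝ] X) : formDomain J₁ J₂ →L[ℝ] X :=
  (ContinuousLinearMap.fst ℝ X X ∘L
    (WithLp.prodContinuousLinearEquiv 2 ℝ X X).toContinuousLinearMap) ∘L
    (formDomain J₁ J₂).subtypeL

/-- The second component of an element of the form domain. -/
noncomputable def formSnd (J₁ J₂ : 𝓓 →ₗ[ℝ] X) : formDomain J₁ J₂ →L[ℝ] X :=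
  (ContinuousLinearMap.snd ℝ X X ∘L
    (WithLp.prodContinuousLinearEquiv 2 ℝ X X).toContinuousLinearMap) ∘L
    (formDomain J₁ J₂).subtypeL

theorem formFst_toFormDomain (J₁ J₂ : 𝓓 →ₗ[ℝ] X) (φ : 𝓓) :
    formFst J₁ J₂ (toFormDomain J₁ J₂ φ) = J₁ φ := rfl

theorem norm_sq_formDomain (J₁ J₂ : 𝓓 →ₗ[ℝ] X) (v : formDomain J₁ J₂) :
    ‖v‖ ^ 2 = ‖formFst J₁ J₂ v‖ ^ 2 + ‖formSnd J₁ J₂ v‖ ^ 2 :=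
  WithLp.prod_norm_sq_eq_of_L2 (v : WithLp 2 (X × X))

/-- The product `X × X` carries the sup norm; passing to the topologically equivalent Hilbert norm
makes Riesz and Lax–Milgram applicable. -/
theorem exists_formDomain_iff (J₁ J₂ : 𝓓 →ₗ[ℝ] X) (u : X) :
    (∃ u', (u, u') ∈ closure (range fun φ => (J₁ φ, J₂ φ))) ↔ ∃ v, formFst J₁ J₂ v = u := by
  constructor
  · rintro ⟨u', h⟩
    refine ⟨⟨WithLp.toLp 2 (u, u'), ?_⟩, rfl⟩
    have := map_mem_closure (t := range (pairMap J₁ J₂))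
      (WithLp.prodContinuousLinearEquiv 2 ℝ X X).symm.continuous h (by
        rintro _ ⟨φ, rfl⟩; exact ⟨φ, rfl⟩)
    exact this
  · rintro ⟨v, rfl⟩
    have hv : (v : WithLp 2 (X × X)) ∈ closure (range (pairMap J₁ J₂)) := v.2
    have := map_mem_closure (t := range fun φ => (J₁ φ, J₂ φ))
      (WithLp.prodContinuousLinearEquiv 2 ℝ X X).continuous hv (by
        rintro _ ⟨φ, rfl⟩; exact ⟨φ, rfl⟩)
    exact ⟨_, this⟩

/-- The graph of the Friedrichs extension of `T`. -/
def friedrichs (J₁ J₂ T : 𝓓 →ₗ[ℝ] X) (u w : X) : Prop :=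
  (∃ u', (u, u') ∈ closure (range fun φ => (J₁ φ, J₂ φ))) ∧
    ∀ φ, inner ℝ u (T φ) = inner ℝ w (J₁ φ)

namespace IsEllipticForm

variable {J₁ J₂ T : 𝓓 →ₗ[ℝ] X} {ε C : ℝ}

/-- The upper bound is assumed only on the diagonal; Cauchy–Schwarz for the nonnegative form spreads
it to pairs. -/
theorem abs_inner_le (h : IsEllipticForm J₁ J₂ T ε C) (φ ψ : 𝓓) :
    |inner ℝ (T φ) (J₁ ψ)| ≤ |C| * ‖toFormDomain J₁ J₂ φ‖ * ‖toFormDomain J₁ J₂ ψ‖ := by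
  let B : LinearMap.BilinForm ℝ 𝓓 := LinearMap.mk₂ ℝ (fun φ ψ => inner ℝ (T φ) (J₁ ψ))
    (fun a b c => by simp only [map_add, inner_add_left])
    (fun c a b => by simp only [map_smul, real_inner_smul_left, smul_eq_mul])
    (fun a b c => by simp only [map_add, inner_add_right])
    (fun c a b => by simp only [map_smul, real_inner_smul_right, smul_eq_mul])
  have hn : ∀ a, 0 ≤ B a a := fun a =>
    (mul_nonneg h.pos.le (sq_nonneg _)).trans (h.lower a)
  have h1 := LinearMap.BilinForm.apply_mul_apply_le_of_forall_zero_le B hn φ ψ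
  have h2 : B ψ φ = B φ ψ := by
    change inner ℝ (T ψ) (J₁ φ) = inner ℝ (T φ) (J₁ ψ)
    rw [h.symm, real_inner_comm]
  rw [h2] at h1
  have h3 : ∀ a, B a a ≤ |C| * ‖toFormDomain J₁ J₂ a‖ ^ 2 := fun a => by
    rw [norm_sq_toFormDomain]
    exact (h.upper a).trans (mul_le_mul_of_nonneg_right (le_abs_self C) (by positivity))
  refine abs_le_of_sq_le_sq ?_ (by positivity)
  have h4 := mul_le_mul (h3 φ) (h3 ψ) (hn ψ) (by positivity)
  calc (B φ ψ) ^ 2 = B φ ψ * B φ ψ := sq _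
    _ ≤ _ := h1.trans h4
    _ = _ := by ring

/-- The form on test functions, as a functional on the form domain. -/
noncomputable def preForm (J₁ J₂ T : 𝓓 →ₗ[ℝ] X) : 𝓓 →ₗ[ℝ] formDomain J₁ J₂ →L[ℝ] ℝ where
  toFun φ := innerSL ℝ (T φ) ∘L formFst J₁ J₂
  map_add' φ ψ := by rw [map_add, map_add, ContinuousLinearMap.add_comp]
  map_smul' c φ := by ext v; simp

theorem preForm_apply (φ : 𝓓) (v : formDomain J₁ J₂) :
    preForm J₁ J₂ T φ v = inner ℝ (T φ) (formFst J₁ J₂ v) := rfl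

theorem norm_preForm_le (h : IsEllipticForm J₁ J₂ T ε C) (φ : 𝓓) :
    ‖preForm J₁ J₂ T φ‖ ≤ |C| * ‖toFormDomain J₁ J₂ φ‖ := by
  refine ContinuousLinearMap.opNorm_le_bound _ (by positivity) fun v => ?_
  refine (denseRange_toFormDomain J₁ J₂).induction_on v
    (isClosed_le (by fun_prop) (by fun_prop)) fun ψ => ?_
  exact h.abs_inner_le φ ψ

/-- The form extended to the form domain. -/
noncomputable def form (J₁ J₂ T : 𝓓 →ₗ[ℝ] X) :
    formDomain J₁ J₂ →L[ℝ] formDomain J₁ J₂ →L[ℝ] ℝ :=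
  extendForm (preForm J₁ J₂ T) (toFormDomain J₁ J₂)

theorem form_left (h : IsEllipticForm J₁ J₂ T ε C) (φ : 𝓓) (v : formDomain J₁ J₂) :
    form J₁ J₂ T (toFormDomain J₁ J₂ φ) v = inner ℝ (T φ) (formFst J₁ J₂ v) := by
  rw [form, extendForm_apply (denseRange_toFormDomain J₁ J₂) h.norm_preForm_le, preForm_apply]

theorem form_right (h : IsEllipticForm J₁ J₂ T ε C) (φ : 𝓓) (v : formDomain J₁ J₂) :
    form J₁ J₂ T v (toFormDomain J₁ J₂ φ) = inner ℝ (formFst J₁ J₂ v) (T φ) := by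
  refine (denseRange_toFormDomain J₁ J₂).induction_on v
    (isClosed_eq (by fun_prop) (by fun_prop)) fun ψ => ?_
  rw [h.form_left, formFst_toFormDomain, formFst_toFormDomain, h.symm]

theorem form_symm (h : IsEllipticForm J₁ J₂ T ε C) (v z : formDomain J₁ J₂) :
    form J₁ J₂ T v z = form J₁ J₂ T z v := by
  refine (denseRange_toFormDomain J₁ J₂).induction_on z
    (isClosed_eq (by fun_prop) (by fun_prop)) fun ψ => ?_
  rw [h.form_right, h.form_left, real_inner_comm]

theorem le_form (h : IsEllipticForm J₁ J₂ T ε C) (v : formDomain J₁ J₂) :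
    ε * ‖formSnd J₁ J₂ v‖ ^ 2 ≤ form J₁ J₂ T v v := by
  refine (denseRange_toFormDomain J₁ J₂).induction_on v
    (isClosed_le (by fun_prop) (by fun_prop)) fun ψ => ?_
  rw [h.form_left]
  exact h.lower ψ

/-- The distributional equation extends by density from test functions to the whole form domain, so
it may be tested with the solution itself. It holds for every lift `v` of `u`, so injectivity of
`formFst` is never needed. -/
theorem form_eq_of_friedrichs (h : IsEllipticForm J₁ J₂ T ε C) {w : X} {v : formDomain J₁ J₂}
    (hw : ∀ φ, inner ℝ (formFst J₁ J₂ v) (T φ) = inner ℝ w (J₁ φ)) (z : formDomain J₁ J₂) :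
    form J₁ J₂ T v z = inner ℝ w (formFst J₁ J₂ z) := by
  refine (denseRange_toFormDomain J₁ J₂).induction_on z
    (isClosed_eq (by fun_prop) (by fun_prop)) fun ψ => ?_
  rw [h.form_right, hw, formFst_toFormDomain]

/-- The Friedrichs extension is a nonnegative self-adjoint operator. -/
theorem isPosSelfAdjoint (h : IsEllipticForm J₁ J₂ T ε C) :
    IsPosSelfAdjoint (friedrichs J₁ J₂ T) where
  add := by
    rintro u w v z ⟨h1, h2⟩ ⟨h3, h4⟩
    rw [exists_formDomain_iff] at h1 h3
    obtain ⟨p, rfl⟩ := h1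
    obtain ⟨q, rfl⟩ := h3
    refine ⟨(exists_formDomain_iff _ _ _).2 ⟨p + q, map_add _ _ _⟩, fun φ => ?_⟩
    rw [inner_add_left, inner_add_left, h2, h4]
  smul := by
    rintro c u w ⟨h1, h2⟩
    rw [exists_formDomain_iff] at h1
    obtain ⟨p, rfl⟩ := h1
    refine ⟨(exists_formDomain_iff _ _ _).2 ⟨c • p, map_smul _ _ _⟩, fun φ => ?_⟩
    rw [real_inner_smul_left, real_inner_smul_left, h2]
  symm := by
    rintro u w v z ⟨h1, h2⟩ ⟨h3, h4⟩
    rw [exists_formDomain_iff] at h1 h3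
    obtain ⟨p, rfl⟩ := h1
    obtain ⟨q, rfl⟩ := h3
    rw [← h.form_eq_of_friedrichs h2, h.form_symm, h.form_eq_of_friedrichs h4, real_inner_comm]
  nonneg := by
    rintro u w ⟨h1, h2⟩
    rw [exists_formDomain_iff] at h1
    obtain ⟨p, rfl⟩ := h1
    rw [← h.form_eq_of_friedrichs h2]
    exact (mul_nonneg h.pos.le (sq_nonneg _)).trans (h.le_form p)
  single_valued := by
    rintro w ⟨-, h2⟩
    refine h.eq_zero w fun φ => ?_
    rw [← h2, inner_zero_left]
  surjective := by
    intro l hl x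
    let B : formDomain J₁ J₂ →L[ℝ] formDomain J₁ J₂ →L[ℝ] ℝ :=
      form J₁ J₂ T + l • pullbackInner (formFst J₁ J₂)
    have hB : ∀ v z, B v z = form J₁ J₂ T v z + l * inner ℝ (formFst J₁ J₂ v) (formFst J₁ J₂ z) :=
      fun v z => rfl
    -- The form controls only the derivative component, with `ε`; the zeroth-order term supplies the
    -- missing component, with `l`.
    have hco : IsCoercive B := by
      refine ⟨min ε l, lt_min h.pos hl, fun v => ?_⟩
      rw [hB, mul_assoc, ← sq, norm_sq_formDomain, real_inner_self_eq_norm_sq]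
      have h1 := h.le_form v
      have h2 := mul_le_mul_of_nonneg_right (min_le_left ε l) (sq_nonneg ‖formSnd J₁ J₂ v‖)
      have h3 := mul_le_mul_of_nonneg_right (min_le_right ε l) (sq_nonneg ‖formFst J₁ J₂ v‖)
      linarith
    set y := (InnerProductSpace.toDual ℝ (formDomain J₁ J₂)).symm (innerSL ℝ x ∘L formFst J₁ J₂)
    obtain ⟨v, hv⟩ := hco.continuousLinearEquivOfBilin.surjective y
    have h1 : ∀ z, B v z = inner ℝ x (formFst J₁ J₂ z) := fun z => by
      rw [← hco.continuousLinearEquivOfBilin_apply, hv, InnerProductSpace.toDual_symm_apply]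
      rfl
    refine ⟨formFst J₁ J₂ v, x - l • formFst J₁ J₂ v,
      ⟨(exists_formDomain_iff _ _ _).2 ⟨v, rfl⟩, fun φ => ?_⟩, by abel⟩
    have h2 := h1 (toFormDomain J₁ J₂ φ)
    rw [hB, h.form_right, formFst_toFormDomain] at h2
    rw [inner_sub_left, real_inner_smul_left]
    linarith

end IsEllipticForm

end Friedrichs

/-! ### The fractional Laplacian of test functions and its quadratic form -/

section FractionalLaplacian

/-- The second difference quotient whose integral is the fractional Laplacian. -/
noncomputable def secondDiff (φ : ℝ → ℝ) (x h : ℝ) : ℝ := 2 * φ x - φ (x + h) - φ (x - h)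

/-- The fractional Laplacian without its normalization, as an absolutely convergent integral. -/
noncomputable def fracIntegral (α : ℝ) (φ : ℝ → ℝ) (x : ℝ) : ℝ :=
  ∫ h in Ioi (0 : ℝ), secondDiff φ x h / h ^ (1 + α)

theorem fracConst_nonneg {α : ℝ} (h₀ : 0 < α) (h₂ : α < 2) : 0 ≤ fracConst α := by
  have h1 := Real.Gamma_pos_of_pos (show 0 < (1 + α) / 2 by linarith)
  have h2 := Real.Gamma_pos_of_pos (show 0 < 1 - α / 2 by linarith)
  have := Real.pi_pos
  unfold fracConst
  positivity

/-- The kernel is `h^{1-α}` near `0`, integrable as `α < 2`, and `h^{-1-α}` at infinity, integrable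
as `α > 0`. It dominates all the integrands below. -/
theorem integrableOn_kernel {α : ℝ} (h₀ : 0 < α) (h₂ : α < 2) :
    IntegrableOn (fun h : ℝ => min 1 (h ^ 2) / h ^ (1 + α)) (Ioi 0) := by
  rw [← Ioc_union_Ioi_eq_Ioi (zero_le_one (α := ℝ))]
  have hm : Measurable (fun h : ℝ => min 1 (h ^ 2) / h ^ (1 + α)) := by fun_prop
  refine IntegrableOn.union ?_ ?_
  · have h1 : IntegrableOn (fun h : ℝ => h ^ (1 - α)) (Ioc 0 1) :=
      (intervalIntegrable_iff_integrableOn_Ioc_of_le zero_le_one).1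
        (intervalIntegral.intervalIntegrable_rpow' (by linarith))
    refine h1.mono' hm.aestronglyMeasurable ?_
    filter_upwards [ae_restrict_mem measurableSet_Ioc] with h hh
    have hp : 0 < h ^ (1 + α) := Real.rpow_pos_of_pos hh.1 _
    rw [Real.norm_of_nonneg (by positivity), div_le_iff₀ hp, ← Real.rpow_add hh.1]
    refine (min_le_right _ _).trans (le_of_eq ?_)
    rw [show 1 - α + (1 + α) = (2 : ℕ) by push_cast; ring, Real.rpow_natCast]
  · have h1 : IntegrableOn (fun h : ℝ => h ^ (-(1 + α))) (Ioi 1) :=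
      integrableOn_Ioi_rpow_of_lt (by linarith) one_pos
    refine h1.mono' hm.aestronglyMeasurable ?_
    filter_upwards [ae_restrict_mem measurableSet_Ioi] with h hh
    have hh0 : (0 : ℝ) < h := one_pos.trans hh
    have hp : 0 < h ^ (1 + α) := Real.rpow_pos_of_pos hh0 _
    rw [Real.norm_of_nonneg (by positivity), Real.rpow_neg hh0.le, ← one_div]
    exact div_le_div_of_nonneg_right (min_le_left _ _) hp.le

theorem kernel_nonneg (α : ℝ) {h : ℝ} (hh : 0 < h) : 0 ≤ min 1 (h ^ 2) / h ^ (1 + α) := by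
  have hp : 0 < h ^ (1 + α) := Real.rpow_pos_of_pos hh _
  positivity

variable {φ ψ : ℝ → ℝ} {α : ℝ}

theorem exists_secondDiff_le (hφ : ContDiff ℝ ∞ φ) (hs : HasCompactSupport φ) :
    ∃ C, 0 ≤ C ∧ ∀ x h, |secondDiff φ x h| ≤ C * min 1 (h ^ 2) := by
  obtain ⟨M, hM⟩ := hs.exists_bound_of_continuous hφ.continuous
  have hd1 : ContDiff ℝ ∞ (deriv φ) := by
    rw [contDiff_infty_iff_deriv] at hφ; exact hφ.2
  have hd2 : ContDiff ℝ ∞ (deriv (deriv φ)) := by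
    rw [contDiff_infty_iff_deriv] at hd1; exact hd1.2
  obtain ⟨K, hK⟩ := hs.deriv.deriv.exists_bound_of_continuous hd2.continuous
  have hM0 : 0 ≤ M := (norm_nonneg _).trans (hM 0)
  have hK0 : 0 ≤ K := (norm_nonneg _).trans (hK 0)
  have hdφ : ∀ x, HasDerivAt φ (deriv φ x) x := fun x =>
    (hφ.differentiable (by simp) x).hasDerivAt
  have hlip : ∀ a b, |deriv φ a - deriv φ b| ≤ K * |a - b| := fun a b =>
    Convex.norm_image_sub_le_of_norm_deriv_le (s := univ) (f := deriv φ)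
      (fun x _ => hd1.differentiable (by simp) x) (fun x _ => hK x) convex_univ
      (mem_univ b) (mem_univ a)
  have hpos : ∀ x h, 0 ≤ h → |secondDiff φ x h| ≤ 2 * K * h ^ 2 := by
    intro x h hh
    -- The first-order terms cancel: the `r`-derivative is a difference of values of `φ'` at
    -- distance `2r`, hence at most `2Kr ≤ 2Kh`.
    have hd : ∀ r, HasDerivAt (fun r => secondDiff φ x r)
        (deriv φ (x - r) - deriv φ (x + r)) r := fun r => by
      have h1 := (hdφ (x + r)).comp_const_add x r
      have h2 := (hdφ (x - r)).comp_const_sub x r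
      refine ((h1.const_sub (2 * φ x)).sub h2).congr_deriv (by ring)
    have := norm_image_sub_le_of_norm_deriv_le_segment' (f := fun r => secondDiff φ x r)
      (f' := fun r => deriv φ (x - r) - deriv φ (x + r)) (C := 2 * K * h) (a := 0) (b := h)
      (fun r _ => (hd r).hasDerivWithinAt) (fun r hr => by
        refine (hlip _ _).trans ?_
        rw [show x - r - (x + r) = -(2 * r) by ring, abs_neg, abs_of_nonneg (by linarith [hr.1])]
        nlinarith [hr.2]) h ⟨hh, le_rfl⟩
    have h0 : secondDiff φ x 0 = 0 := by simp [secondDiff]; ring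
    rw [h0, sub_zero, sub_zero, Real.norm_eq_abs] at this
    linarith
  refine ⟨4 * M + 2 * K, by positivity, fun x h => ?_⟩
  have hA : |secondDiff φ x h| ≤ 4 * M := by
    have h1 := abs_le.1 (hM x)
    have h2 := abs_le.1 (hM (x + h))
    have h3 := abs_le.1 (hM (x - h))
    rw [secondDiff, abs_le]
    constructor <;> linarith [h1.1, h1.2, h2.1, h2.2, h3.1, h3.2]
  have hB : |secondDiff φ x h| ≤ 2 * K * h ^ 2 := by
    rcases le_total 0 h with hh | hh
    · exact hpos x h hh
    · have h1 := hpos x (-h) (by linarith)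
      have e : secondDiff φ x (-h) = secondDiff φ x h := by
        simp only [secondDiff, sub_neg_eq_add, ← sub_eq_add_neg]; ring
      rwa [e, neg_sq] at h1
  rcases le_total 1 (h ^ 2) with h1 | h1
  · rw [min_eq_left h1]; linarith
  · rw [min_eq_right h1]; nlinarith [sq_nonneg h]

theorem continuous_secondDiff (hφ : Continuous φ) :
    Continuous fun p : ℝ × ℝ => secondDiff φ p.1 p.2 := by
  unfold secondDiff; fun_prop

theorem measurable_integrand (hφ : Continuous φ) (α : ℝ) :
    Measurable fun p : ℝ × ℝ => secondDiff φ p.1 p.2 / p.2 ^ (1 + α) :=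
  (continuous_secondDiff hφ).measurable.div (by fun_prop)

theorem measurable_integrand_right (hφ : Continuous φ) (α x : ℝ) :
    Measurable fun h : ℝ => secondDiff φ x h / h ^ (1 + α) :=
  (measurable_integrand hφ α).comp measurable_prodMk_left

theorem norm_integrand_le {C : ℝ} (hC : ∀ x h, |secondDiff φ x h| ≤ C * min 1 (h ^ 2)) (x : ℝ)
    {h : ℝ} (hh : 0 < h) :
    ‖secondDiff φ x h / h ^ (1 + α)‖ ≤ C * (min 1 (h ^ 2) / h ^ (1 + α)) := by
  have hp : 0 < h ^ (1 + α) := Real.rpow_pos_of_pos hh _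
  rw [norm_div, Real.norm_of_nonneg hp.le, mul_div_assoc']
  exact div_le_div_of_nonneg_right (hC x h) hp.le

theorem integrableOn_integrand (h₀ : 0 < α) (h₂ : α < 2) (hφ : ContDiff ℝ ∞ φ)
    (hs : HasCompactSupport φ) (x : ℝ) :
    IntegrableOn (fun h : ℝ => secondDiff φ x h / h ^ (1 + α)) (Ioi 0) := by
  obtain ⟨C, -, hC⟩ := exists_secondDiff_le hφ hs
  refine ((integrableOn_kernel h₀ h₂).const_mul C).mono'
    (measurable_integrand_right hφ.continuous α x).aestronglyMeasurable ?_
  filter_upwards [ae_restrict_mem measurableSet_Ioi] with h hh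
  exact norm_integrand_le hC x hh

theorem measurable_fracIntegral (hφ : Continuous φ) (α : ℝ) : Measurable (fracIntegral α φ) :=
  ((measurable_integrand hφ α).stronglyMeasurable.integral_prod_right').measurable

theorem exists_fracIntegral_le (h₀ : 0 < α) (h₂ : α < 2) (hφ : ContDiff ℝ ∞ φ)
    (hs : HasCompactSupport φ) : ∃ C, ∀ x, ‖fracIntegral α φ x‖ ≤ C := by
  obtain ⟨C, -, hC⟩ := exists_secondDiff_le hφ hs
  refine ⟨∫ h in Ioi (0 : ℝ), C * (min 1 (h ^ 2) / h ^ (1 + α)), fun x => ?_⟩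
  refine norm_integral_le_of_norm_le ((integrableOn_kernel h₀ h₂).const_mul C) ?_
  filter_upwards [ae_restrict_mem measurableSet_Ioi] with h hh
  exact norm_integrand_le hC x hh

theorem integrable_truncated_kernel (h₀ : 0 < α) {δ : ℝ} (hδ : 0 < δ) {q : ℝ → ℝ}
    (hq : Measurable q) {M : ℝ} (hM : ∀ h, |q h| ≤ M) :
    Integrable ({h : ℝ | δ ≤ |h|}.indicator fun h => q h / |h| ^ (1 + α)) := by
  have hset : MeasurableSet {h : ℝ | δ ≤ |h|} := measurableSet_le measurable_const (by fun_prop)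
  have hM0 : 0 ≤ M := (abs_nonneg _).trans (hM 0)
  have h1 : Integrable fun h : ℝ => (1 + ‖h‖) ^ (-(1 + α)) :=
    integrable_one_add_norm (by simp; linarith)
  -- The constant comes from `1 / |h| ≤ (1 / δ + 1) / (1 + |h|)` for `|h| ≥ δ`.
  refine (h1.const_mul (M * (1 / δ + 1) ^ (1 + α))).mono'
    ((Measurable.div hq (by fun_prop)).indicator hset).aestronglyMeasurable
    (ae_of_all _ fun h => ?_)
  by_cases hh : δ ≤ |h|
  · have hp : 0 < |h| := hδ.trans_le hh
    rw [indicator_of_mem (show h ∈ {h : ℝ | δ ≤ |h|} from hh), norm_div, Real.norm_eq_abs,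
      Real.norm_of_nonneg (by positivity), Real.rpow_neg (by positivity), mul_assoc,
      ← div_eq_mul_inv, ← Real.div_rpow (by positivity) (by positivity), div_eq_mul_inv]
    refine mul_le_mul (hM h) ?_ (by positivity) hM0
    rw [← Real.inv_rpow hp.le]
    refine Real.rpow_le_rpow (by positivity) ?_ (by linarith)
    rw [le_div_iff₀ (by positivity), Real.norm_eq_abs, inv_mul_le_iff₀ hp]
    have : 1 ≤ |h| * (1 / δ) := by rwa [mul_one_div, le_div_iff₀ hδ, one_mul]
    linarith
  · rw [indicator_of_notMem (show h ∉ {h : ℝ | δ ≤ |h|} from hh), norm_zero]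
    positivity

/-- Substitute `y = x + h` and fold the negative half-line onto the positive one: the two first
differences add up to the second difference. -/
theorem truncated_integral_eq (h₀ : 0 < α) (hφ : Continuous φ) (hs : HasCompactSupport φ)
    (x : ℝ) {δ : ℝ} (hδ : 0 < δ) :
    ∫ y in {y : ℝ | δ ≤ |x - y|}, (φ x - φ y) / |x - y| ^ (1 + α) =
      ∫ h in Ioi (0 : ℝ), (Ici δ).indicator (fun h => secondDiff φ x h / h ^ (1 + α)) h := by
  obtain ⟨M, hM⟩ := hs.exists_bound_of_continuous hφ
  set k : ℝ → ℝ := {h : ℝ | δ ≤ |h|}.indicator fun h => (φ x - φ (x + h)) / |h| ^ (1 + α) with hk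
  have hki : Integrable k := by
    refine integrable_truncated_kernel (M := M + M) h₀ hδ
      (q := fun h => φ x - φ (x + h)) (by fun_prop) fun h => ?_
    exact (abs_sub _ _).trans (add_le_add (hM _) (hM _))
  have hset : MeasurableSet {y : ℝ | δ ≤ |x - y|} :=
    measurableSet_le measurable_const (by fun_prop)
  rw [← integral_indicator hset, ← integral_add_left_eq_self _ x]
  have e1 : (fun h => {y : ℝ | δ ≤ |x - y|}.indicator
      (fun y => (φ x - φ y) / |x - y| ^ (1 + α)) (x + h)) = k := by
    ext h
    simp only [hk, indicator_apply, mem_ofPred_eq, sub_add_cancel_left, abs_neg]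
  rw [e1, ← intervalIntegral.integral_Iic_add_Ioi (b := 0) hki.integrableOn hki.integrableOn]
  have e2 : ∫ h in Iic (0 : ℝ), k h = ∫ h in Ioi (0 : ℝ), k (-h) := by
    rw [integral_comp_neg_Ioi 0 k, neg_zero]
  rw [e2, ← integral_add hki.comp_neg.integrableOn hki.integrableOn]
  refine setIntegral_congr_fun measurableSet_Ioi fun h hh => ?_
  have hh0 : |h| = h := abs_of_pos hh
  simp only [hk, indicator_apply, mem_ofPred_eq, abs_neg, hh0, mem_Ici, secondDiff]
  split_ifs with hc
  · rw [← add_div]; congr 1; rw [← sub_eq_add_neg]; ring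
  · simp

/-- After symmetrization the integrand is absolutely integrable, so dominated convergence removes
the truncation in the principal value. -/
theorem fracLaplacian_eq (h₀ : 0 < α) (h₂ : α < 2) (hφ : ContDiff ℝ ∞ φ)
    (hs : HasCompactSupport φ) (x : ℝ) :
    fracLaplacian α φ x = fracConst α * fracIntegral α φ x := by
  unfold fracLaplacian
  congr 1
  refine Tendsto.limUnder_eq ?_
  have hint := integrableOn_integrand h₀ h₂ hφ hs x
  have h1 : Tendsto (fun δ : ℝ => ∫ h in Ioi (0 : ℝ),
      (Ici δ).indicator (fun h => secondDiff φ x h / h ^ (1 + α)) h) (𝓝[>] 0)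
      (𝓝 (fracIntegral α φ x)) := by
    refine tendsto_integral_filter_of_dominated_convergence
      (fun h => ‖secondDiff φ x h / h ^ (1 + α)‖) (Eventually.of_forall fun δ =>
        hint.aestronglyMeasurable.indicator measurableSet_Ici)
      (Eventually.of_forall fun δ => ae_of_all _ fun h => norm_indicator_le_norm_self _ _)
      hint.norm ?_
    filter_upwards [ae_restrict_mem measurableSet_Ioi] with h hh
    refine tendsto_const_nhds.congr' ?_
    filter_upwards [mem_nhdsWithin_of_mem_nhds (Iio_mem_nhds hh)] with δ hδ
    rw [indicator_of_mem (show h ∈ Ici δ from mem_Ici.2 (le_of_lt hδ))]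
  refine h1.congr' ?_
  filter_upwards [self_mem_nhdsWithin] with δ hδ
  exact (truncated_integral_eq h₀ hφ.continuous hs x hδ).symm

/-- Discrete integration by parts: translating by `h` moves half of the second difference onto `ψ`.
Symmetry and positivity of the fractional form are read off from the right-hand side. -/
theorem integral_mul_secondDiff (hφ : Continuous φ) (hs : HasCompactSupport φ)
    (hψ : Continuous ψ) (h : ℝ) :
    ∫ x, ψ x * secondDiff φ x h = ∫ x, (ψ x - ψ (x + h)) * (φ x - φ (x + h)) := by
  have hint : ∀ a b : ℝ, Integrable fun x => ψ (x + a) * φ (x + b) := fun a b =>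
    Continuous.integrable_of_hasCompactSupport (by fun_prop)
      ((hs.comp_homeomorph (Homeomorph.addRight b)).mul_left)
  have i00 : Integrable fun x => ψ x * φ x := by simpa using hint 0 0
  have i0h : Integrable fun x => ψ x * φ (x + h) := by simpa using hint 0 h
  have ih0 : Integrable fun x => ψ (x + h) * φ x := by simpa using hint h 0
  have i0m : Integrable fun x => ψ x * φ (x - h) := by simpa [sub_eq_add_neg] using hint 0 (-h)
  have e1 : ∫ x, ψ x * φ (x - h) = ∫ x, ψ (x + h) * φ x := by
    rw [← integral_add_right_eq_self (fun x => ψ x * φ (x - h)) h]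
    simp
  have e2 : ∫ x, ψ (x + h) * φ (x + h) = ∫ x, ψ x * φ x :=
    integral_add_right_eq_self (fun x => ψ x * φ x) h
  have l : ∀ x, ψ x * secondDiff φ x h =
      ψ x * φ x + ψ x * φ x - ψ x * φ (x + h) - ψ x * φ (x - h) := fun x => by
    unfold secondDiff; ring
  have r : ∀ x, (ψ x - ψ (x + h)) * (φ x - φ (x + h)) =
      ψ x * φ x - ψ x * φ (x + h) - ψ (x + h) * φ x + ψ (x + h) * φ (x + h) := fun x => by ring
  simp only [l, r]
  have j1 : Integrable fun x => ψ x * φ x + ψ x * φ x := i00.add i00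
  have j2 : Integrable fun x => ψ x * φ x + ψ x * φ x - ψ x * φ (x + h) := j1.sub i0h
  have j3 : Integrable fun x => ψ x * φ x - ψ x * φ (x + h) := i00.sub i0h
  have j4 : Integrable fun x => ψ x * φ x - ψ x * φ (x + h) - ψ (x + h) * φ x := j3.sub ih0
  rw [integral_sub j2 i0m, integral_sub j1 i0h, integral_add i00 i00, integral_add j4 (hint h h),
    integral_sub j3 ih0, integral_sub i00 i0h, e1, e2]
  ring

theorem integral_mul_fracIntegral (h₀ : 0 < α) (h₂ : α < 2) (hφ : ContDiff ℝ ∞ φ)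
    (hs : HasCompactSupport φ) (hψ : Continuous ψ) (ht : HasCompactSupport ψ) :
    ∫ x, ψ x * fracIntegral α φ x = ∫ h in Ioi (0 : ℝ),
      (∫ x, (ψ x - ψ (x + h)) * (φ x - φ (x + h))) / h ^ (1 + α) := by
  obtain ⟨C, -, hC⟩ := exists_secondDiff_le hφ hs
  unfold fracIntegral
  simp only [← integral_const_mul]
  rw [integral_integral_swap (f := fun x h => ψ x * (secondDiff φ x h / h ^ (1 + α)))]
  · refine integral_congr_ae (ae_of_all _ fun h => ?_)
    simp only [← integral_mul_secondDiff hφ.continuous hs hψ h, ← integral_div, mul_div_assoc]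
  · have h1 : Integrable (fun p : ℝ × ℝ => ‖ψ p.1‖ * (C * (min 1 (p.2 ^ 2) / p.2 ^ (1 + α))))
        (volume.prod (volume.restrict (Ioi 0))) :=
      (hψ.integrable_of_hasCompactSupport ht).norm.mul_prod
        ((integrableOn_kernel h₀ h₂).const_mul C)
    refine h1.mono' ((hψ.measurable.comp measurable_fst).mul
      (measurable_integrand hφ.continuous α)).aestronglyMeasurable ?_
    have h2 : ∀ᵐ p : ℝ × ℝ ∂(volume.prod (volume.restrict (Ioi 0))), p.2 ∈ Ioi (0 : ℝ) :=
      Measure.quasiMeasurePreserving_snd.ae (ae_restrict_mem measurableSet_Ioi)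
    filter_upwards [h2] with p hp
    rw [Function.uncurry, norm_mul]
    exact mul_le_mul_of_nonneg_left (norm_integrand_le hC _ hp) (norm_nonneg _)

theorem integral_mul_fracIntegral_comm (h₀ : 0 < α) (h₂ : α < 2) (hφ : ContDiff ℝ ∞ φ)
    (hs : HasCompactSupport φ) (hψ : ContDiff ℝ ∞ ψ) (ht : HasCompactSupport ψ) :
    ∫ x, ψ x * fracIntegral α φ x = ∫ x, φ x * fracIntegral α ψ x := by
  rw [integral_mul_fracIntegral h₀ h₂ hφ hs hψ.continuous ht,
    integral_mul_fracIntegral h₀ h₂ hψ ht hφ.continuous hs]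
  simp only [mul_comm]

theorem integral_mul_fracIntegral_nonneg (h₀ : 0 < α) (h₂ : α < 2) (hφ : ContDiff ℝ ∞ φ)
    (hs : HasCompactSupport φ) : 0 ≤ ∫ x, φ x * fracIntegral α φ x := by
  rw [integral_mul_fracIntegral h₀ h₂ hφ hs hφ.continuous hs]
  refine setIntegral_nonneg measurableSet_Ioi fun h hh => ?_
  exact div_nonneg (integral_nonneg fun x => mul_self_nonneg _)
    (Real.rpow_nonneg (le_of_lt hh) _)

theorem sq_sub_le (hφ : ContDiff ℝ ∞ φ) (x : ℝ) {h : ℝ} (hh : 0 < h) :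
    (φ x - φ (x + h)) ^ 2 ≤ h * ∫ s in (0 : ℝ)..h, deriv φ (x + s) ^ 2 := by
  have hdc : Continuous (deriv φ) := hφ.continuous_deriv (by simp)
  set a := φ (x + h) - φ x with ha
  have h1 : ∫ s in (0 : ℝ)..h, deriv φ (x + s) = a := by
    rw [intervalIntegral.integral_comp_add_left (fun s => deriv φ s), add_zero,
      intervalIntegral.integral_deriv_eq_sub (fun y _ => hφ.differentiable (by simp) y)
        (hdc.intervalIntegrable _ _)]
  -- Cauchy–Schwarz by expanding a square: `a / h` is the mean of `φ'` over the interval, and the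
  -- variance is nonnegative.
  have h2 : 0 ≤ ∫ s in (0 : ℝ)..h, (h * deriv φ (x + s) - a) ^ 2 :=
    intervalIntegral.integral_nonneg hh.le fun s _ => sq_nonneg _
  have e : ∀ s, (h * deriv φ (x + s) - a) ^ 2 =
      h ^ 2 * deriv φ (x + s) ^ 2 - 2 * h * a * deriv φ (x + s) + a ^ 2 := fun s => by ring
  simp only [e] at h2
  rw [intervalIntegral.integral_add (Continuous.intervalIntegrable (by fun_prop) _ _)
      (Continuous.intervalIntegrable (by fun_prop) _ _),
    intervalIntegral.integral_sub (Continuous.intervalIntegrable (by fun_prop) _ _)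
      (Continuous.intervalIntegrable (by fun_prop) _ _),
    intervalIntegral.integral_const_mul, intervalIntegral.integral_const_mul, h1,
    intervalIntegral.integral_const, sub_zero, smul_eq_mul] at h2
  have h3 : (φ x - φ (x + h)) ^ 2 = a ^ 2 := by rw [ha]; ring
  rw [h3]
  refine le_of_mul_le_mul_left ?_ hh
  nlinarith

theorem integral_sq_sub_le (hφ : ContDiff ℝ ∞ φ) (hs : HasCompactSupport φ) {h : ℝ} (hh : 0 < h) :
    ∫ x, (φ x - φ (x + h)) ^ 2 ≤ h ^ 2 * ∫ x, deriv φ x ^ 2 := by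
  have hdc : Continuous (deriv φ) := hφ.continuous_deriv (by simp)
  have hsq : Integrable fun x => deriv φ x ^ 2 :=
    Continuous.integrable_of_hasCompactSupport (by fun_prop)
      (hs.deriv.comp_left (g := fun y => y ^ 2) (by simp))
  have hprod : Integrable (fun p : ℝ × ℝ => deriv φ (p.1 + p.2) ^ 2)
      (volume.prod (volume.restrict (Ioc 0 h))) := by
    rw [integrable_prod_iff' (Continuous.aestronglyMeasurable (by fun_prop))]
    refine ⟨ae_of_all _ fun s => hsq.comp_add_right s, ?_⟩
    have e : ∀ s : ℝ, ∫ x, ‖deriv φ (x + s) ^ 2‖ = ∫ x, ‖deriv φ x ^ 2‖ := fun s =>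
      integral_add_right_eq_self (fun x => ‖deriv φ x ^ 2‖) s
    simp only [e]
    exact integrable_const _
  have h1 : ∫ x, ∫ s in (0 : ℝ)..h, deriv φ (x + s) ^ 2 = h * ∫ x, deriv φ x ^ 2 := by
    simp only [intervalIntegral.integral_of_le hh.le]
    rw [integral_integral_swap (f := fun x s => deriv φ (x + s) ^ 2) hprod]
    have e : ∀ s : ℝ, ∫ x, deriv φ (x + s) ^ 2 = ∫ x, deriv φ x ^ 2 := fun s =>
      integral_add_right_eq_self (fun x => deriv φ x ^ 2) s
    simp [e, hh.le]
  have hi : Integrable fun x => ∫ s in (0 : ℝ)..h, deriv φ (x + s) ^ 2 := by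
    simp only [intervalIntegral.integral_of_le hh.le]
    exact hprod.integral_prod_left
  calc ∫ x, (φ x - φ (x + h)) ^ 2 ≤ ∫ x, h * ∫ s in (0 : ℝ)..h, deriv φ (x + s) ^ 2 :=
        integral_mono_of_nonneg (ae_of_all _ fun x => sq_nonneg _) (hi.const_mul h)
          (ae_of_all _ fun x => sq_sub_le hφ x hh)
    _ = h ^ 2 * ∫ x, deriv φ x ^ 2 := by rw [integral_const_mul, h1]; ring

theorem integral_sq_sub_le' (hφ : Continuous φ) (hs : HasCompactSupport φ) (h : ℝ) :
    ∫ x, (φ x - φ (x + h)) ^ 2 ≤ 4 * ∫ x, φ x ^ 2 := by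
  have hsq : Integrable fun x => φ x ^ 2 :=
    Continuous.integrable_of_hasCompactSupport (by fun_prop)
      (hs.comp_left (g := fun y => y ^ 2) (by simp))
  have hsq' : Integrable fun x => φ (x + h) ^ 2 := hsq.comp_add_right h
  calc ∫ x, (φ x - φ (x + h)) ^ 2 ≤ ∫ x, (2 * φ x ^ 2 + 2 * φ (x + h) ^ 2) :=
        integral_mono_of_nonneg (ae_of_all _ fun x => sq_nonneg _)
          ((hsq.const_mul 2).add (hsq'.const_mul 2))
          (ae_of_all _ fun x => by nlinarith [sq_nonneg (φ x + φ (x + h))])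
    _ = 4 * ∫ x, φ x ^ 2 := by
        rw [integral_add (hsq.const_mul 2) (hsq'.const_mul 2), integral_const_mul,
          integral_const_mul, integral_add_right_eq_self (fun x => φ x ^ 2) h]
        ring

/-- Squared differences cost `h² ‖φ'‖²` for small `h` and `4 ‖φ‖²` for large `h`; together they
produce the integrable kernel with `min 1 (h ^ 2)`. -/
theorem exists_integral_mul_fracIntegral_le (h₀ : 0 < α) (h₂ : α < 2) :
    ∃ C, 0 ≤ C ∧ ∀ φ : ℝ → ℝ, ContDiff ℝ ∞ φ → HasCompactSupport φ →
      ∫ x, φ x * fracIntegral α φ x ≤ C * ((∫ x, φ x ^ 2) + ∫ x, deriv φ x ^ 2) := by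
  refine ⟨4 * ∫ h in Ioi (0 : ℝ), min 1 (h ^ 2) / h ^ (1 + α), ?_, fun φ hφ hs => ?_⟩
  · exact mul_nonneg (by norm_num)
      (setIntegral_nonneg measurableSet_Ioi fun h hh => kernel_nonneg α hh)
  rw [integral_mul_fracIntegral h₀ h₂ hφ hs hφ.continuous hs]
  set E := (∫ x, φ x ^ 2) + ∫ x, deriv φ x ^ 2 with hE
  have hE1 : 0 ≤ ∫ x, φ x ^ 2 := integral_nonneg fun x => sq_nonneg _
  have hE2 : 0 ≤ ∫ x, deriv φ x ^ 2 := integral_nonneg fun x => sq_nonneg _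
  have hb : ∀ h : ℝ, 0 < h → ∫ x, (φ x - φ (x + h)) * (φ x - φ (x + h)) ≤
      4 * min 1 (h ^ 2) * E := fun h hh => by
    have h1 := integral_sq_sub_le hφ hs hh
    have h2 := integral_sq_sub_le' hφ.continuous hs h
    simp only [← sq]
    rcases le_total 1 (h ^ 2) with h3 | h3
    · rw [min_eq_left h3]; linarith
    · rw [min_eq_right h3]; nlinarith [sq_nonneg h]
  rw [mul_assoc, ← integral_mul_const, ← integral_const_mul]
  refine integral_mono_of_nonneg ?_
    (((integrableOn_kernel h₀ h₂).mul_const E).const_mul 4) ?_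
  · filter_upwards [ae_restrict_mem measurableSet_Ioi] with h hh
    exact div_nonneg (integral_nonneg fun x => mul_self_nonneg _)
      (Real.rpow_nonneg (le_of_lt hh) _)
  · filter_upwards [ae_restrict_mem measurableSet_Ioi] with h hh
    have hp : 0 < h ^ (1 + α) := Real.rpow_pos_of_pos hh _
    refine (div_le_div_of_nonneg_right (hb h hh) hp.le).trans (le_of_eq ?_)
    ring

end FractionalLaplacian

/-! ### The operator `A_ε` as a Friedrichs extension -/

section Operator

instance : IsFiniteMeasure μΩ := by
  unfold μΩ Ω; infer_instance

theorem measurableSet_Ω : MeasurableSet Ω := measurableSet_Ioo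

/-- The space `C_c^∞(Ω)`. -/
def testFunctions : Submodule ℝ (ℝ → ℝ) where
  carrier := {φ | IsTestFunction φ}
  add_mem' {φ ψ} hφ hψ :=
    ⟨hφ.smooth.add hψ.smooth, hφ.compactSupport.add hψ.compactSupport,
      (tsupport_add φ ψ).trans (union_subset hφ.support_subset hψ.support_subset)⟩
  zero_mem' := ⟨contDiff_const, HasCompactSupport.zero, by simp⟩
  smul_mem' c φ hφ :=
    ⟨hφ.smooth.const_smul c, hφ.compactSupport.smul_left (f := fun _ => c),
      (tsupport_smul_subset_right (fun _ => c) φ).trans hφ.support_subset⟩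

theorem IsTestFunction.deriv {φ : ℝ → ℝ} (hφ : IsTestFunction φ) : IsTestFunction (deriv φ) :=
  ⟨(contDiff_infty_iff_deriv.1 hφ.smooth).2, hφ.compactSupport.deriv,
    (closure_minimal (support_deriv_subset (f := φ)) (isClosed_tsupport φ)).trans
      hφ.support_subset⟩

theorem IsTestFunction.eq_zero {φ : ℝ → ℝ} (hφ : IsTestFunction φ) {x : ℝ} (hx : x ∉ Ω) :
    φ x = 0 :=
  image_eq_zero_of_notMem_tsupport fun h => hx (hφ.support_subset h)

/-- Differentiation on the space of test functions. -/
noncomputable def testDeriv : testFunctions →ₗ[ℝ] testFunctions where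
  toFun φ := ⟨deriv φ, IsTestFunction.deriv φ.2⟩
  map_add' φ ψ := by
    ext x
    exact deriv_add (φ.2.smooth.differentiable (by simp) x) (ψ.2.smooth.differentiable (by simp) x)
  map_smul' c φ := by
    ext x
    exact deriv_const_smul c (φ.2.smooth.differentiable (by simp) x)

theorem testDeriv_apply (φ : testFunctions) : (testDeriv φ : ℝ → ℝ) = deriv φ := rfl

theorem IsTestFunction.memLp {φ : ℝ → ℝ} (hφ : IsTestFunction φ) : MemLp φ 2 μΩ :=
  (hφ.smooth.continuous.memLp_of_hasCompactSupport hφ.compactSupport).restrict _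

/-- The embedding of the test functions into `L²(Ω)`. -/
noncomputable def testToLp : testFunctions →ₗ[ℝ] H where
  toFun φ := (IsTestFunction.memLp φ.2).toLp φ
  map_add' _ _ := rfl
  map_smul' _ _ := rfl

theorem coeFn_testToLp (φ : testFunctions) : (testToLp φ : ℝ → ℝ) =ᵐ[μΩ] φ :=
  (IsTestFunction.memLp φ.2).coeFn_toLp

theorem inner_H (u w : H) : inner ℝ u w = ∫ x in Ω, u x * w x := by
  rw [L2.inner_def]
  refine integral_congr_ae (ae_of_all _ fun x => ?_)
  simp [mul_comm]

theorem inner_eq_of_ae {u w : H} {a b : ℝ → ℝ} (hu : (u : ℝ → ℝ) =ᵐ[μΩ] a)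
    (hw : (w : ℝ → ℝ) =ᵐ[μΩ] b) : inner ℝ u w = ∫ x in Ω, a x * b x := by
  rw [inner_H]
  refine integral_congr_ae ?_
  filter_upwards [hu, hw] with x h1 h2
  rw [h1, h2]

theorem integral_Ω_mul {φ : ℝ → ℝ} (hφ : IsTestFunction φ) (q : ℝ → ℝ) :
    ∫ x in Ω, φ x * q x = ∫ x, φ x * q x :=
  setIntegral_eq_integral_of_forall_compl_eq_zero fun x hx => by rw [hφ.eq_zero hx, zero_mul]

theorem norm_sq_testToLp (φ : testFunctions) : ‖testToLp φ‖ ^ 2 = ∫ x, (φ : ℝ → ℝ) x ^ 2 := by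
  rw [← real_inner_self_eq_norm_sq, inner_eq_of_ae (coeFn_testToLp φ) (coeFn_testToLp φ),
    integral_Ω_mul φ.2]
  simp only [sq]

variable {α : ℝ}

/-- The fractional Laplacian of a test function is nonlocal and need not vanish near the boundary of
`Ω`, but it is bounded and `Ω` has finite measure. -/
theorem memLp_fracIntegral (h₀ : 0 < α) (h₂ : α < 2) (φ : testFunctions) :
    MemLp (fracIntegral α φ) 2 μΩ := by
  obtain ⟨C, hC⟩ := exists_fracIntegral_le h₀ h₂ φ.2.smooth φ.2.compactSupport
  exact MemLp.of_bound (measurable_fracIntegral φ.2.smooth.continuous α).aestronglyMeasurable C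
    (ae_of_all _ hC)

theorem fracIntegral_add (h₀ : 0 < α) (h₂ : α < 2) (φ ψ : testFunctions) :
    fracIntegral α (φ + ψ : testFunctions) = fracIntegral α φ + fracIntegral α ψ := by
  ext x
  rw [Pi.add_apply, fracIntegral, fracIntegral, fracIntegral, ← integral_add
    (integrableOn_integrand h₀ h₂ φ.2.smooth φ.2.compactSupport x)
    (integrableOn_integrand h₀ h₂ ψ.2.smooth ψ.2.compactSupport x)]
  congr 1
  ext h
  simp only [secondDiff, Submodule.coe_add, Pi.add_apply]
  ring

theorem fracIntegral_smul (c : ℝ) (φ : testFunctions) :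
    fracIntegral α (c • φ : testFunctions) = c • fracIntegral α φ := by
  ext x
  rw [Pi.smul_apply, fracIntegral, fracIntegral, ← integral_smul]
  congr 1
  ext h
  simp only [secondDiff, Submodule.coe_smul, Pi.smul_apply, smul_eq_mul]
  ring

/-- The unnormalized fractional Laplacian of test functions as an element of `L²(Ω)`. -/
noncomputable def fracToLp (h₀ : 0 < α) (h₂ : α < 2) : testFunctions →ₗ[ℝ] H where
  toFun φ := (memLp_fracIntegral h₀ h₂ φ).toLp _
  map_add' φ ψ := by
    rw [← MemLp.toLp_add]
    exact MemLp.toLp_congr _ _ (ae_of_all _ fun x => congrFun (fracIntegral_add h₀ h₂ φ ψ) x)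
  map_smul' c φ := by
    rw [RingHom.id_apply, ← MemLp.toLp_const_smul]
    exact MemLp.toLp_congr _ _ (ae_of_all _ fun x => congrFun (fracIntegral_smul c φ) x)

theorem coeFn_fracToLp (h₀ : 0 < α) (h₂ : α < 2) (φ : testFunctions) :
    (fracToLp h₀ h₂ φ : ℝ → ℝ) =ᵐ[μΩ] fracIntegral α φ :=
  (memLp_fracIntegral h₀ h₂ φ).coeFn_toLp

/-- The operator `-ε Δ + (-Δ)^(α/2)` on test functions. -/
noncomputable def testOperator (ε : ℝ) (h₀ : 0 < α) (h₂ : α < 2) : testFunctions →ₗ[ℝ] H :=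
  (-ε) • (testToLp ∘ₗ testDeriv ∘ₗ testDeriv) + fracConst α • fracToLp h₀ h₂

theorem testOperator_apply (ε : ℝ) (h₀ : 0 < α) (h₂ : α < 2) (φ : testFunctions) :
    testOperator ε h₀ h₂ φ =
      (-ε) • testToLp (testDeriv (testDeriv φ)) + fracConst α • fracToLp h₀ h₂ φ := rfl

theorem coeFn_testOperator (ε : ℝ) (h₀ : 0 < α) (h₂ : α < 2) (φ : testFunctions) :
    (testOperator ε h₀ h₂ φ : ℝ → ℝ) =ᵐ[μΩ]
      fun x => -ε * iteratedDeriv 2 φ x + fracLaplacian α φ x := by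
  rw [testOperator_apply]
  filter_upwards [Lp.coeFn_add ((-ε) • testToLp (testDeriv (testDeriv φ)))
    (fracConst α • fracToLp h₀ h₂ φ), Lp.coeFn_smul (-ε) (testToLp (testDeriv (testDeriv φ))),
    Lp.coeFn_smul (fracConst α) (fracToLp h₀ h₂ φ), coeFn_testToLp (testDeriv (testDeriv φ)),
    coeFn_fracToLp h₀ h₂ φ] with x h1 h2 h3 h4 h5
  rw [h1, Pi.add_apply, h2, h3, Pi.smul_apply, Pi.smul_apply, h4, h5,
    fracLaplacian_eq h₀ h₂ φ.2.smooth φ.2.compactSupport, iteratedDeriv_succ, iteratedDeriv_one]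
  rfl

theorem inner_testDeriv (φ ψ : testFunctions) :
    inner ℝ (testToLp (testDeriv φ)) (testToLp ψ) =
      -inner ℝ (testToLp φ) (testToLp (testDeriv ψ)) := by
  rw [inner_eq_of_ae (coeFn_testToLp _) (coeFn_testToLp _),
    inner_eq_of_ae (coeFn_testToLp _) (coeFn_testToLp _), integral_Ω_mul (testDeriv φ).2,
    integral_Ω_mul φ.2]
  have hint : ∀ a b : testFunctions, Integrable ((a : ℝ → ℝ) * (b : ℝ → ℝ)) := fun a b =>
    (a.2.smooth.continuous.mul b.2.smooth.continuous).integrable_of_hasCompactSupport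
      b.2.compactSupport.mul_left
  have h := integral_mul_deriv_eq_deriv_mul_of_integrable (u := (φ : ℝ → ℝ)) (v := (ψ : ℝ → ℝ))
    (u' := (testDeriv φ : ℝ → ℝ)) (v' := (testDeriv ψ : ℝ → ℝ))
    (fun x _ => (φ.2.smooth.differentiable (by simp) x).hasDerivAt)
    (fun x _ => (ψ.2.smooth.differentiable (by simp) x).hasDerivAt)
    (hint _ _) (hint _ _) (hint _ _)
  exact (neg_eq_iff_eq_neg.2 h).symm

theorem inner_fracToLp (h₀ : 0 < α) (h₂ : α < 2) (φ ψ : testFunctions) :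
    inner ℝ (fracToLp h₀ h₂ φ) (testToLp ψ) = ∫ x, (ψ : ℝ → ℝ) x * fracIntegral α φ x := by
  rw [real_inner_comm, inner_eq_of_ae (coeFn_testToLp _) (coeFn_fracToLp h₀ h₂ _),
    integral_Ω_mul ψ.2]

theorem inner_testOperator (ε : ℝ) (h₀ : 0 < α) (h₂ : α < 2) (φ ψ : testFunctions) :
    inner ℝ (testOperator ε h₀ h₂ φ) (testToLp ψ) =
      ε * inner ℝ (testToLp (testDeriv φ)) (testToLp (testDeriv ψ)) +
        fracConst α * ∫ x, (ψ : ℝ → ℝ) x * fracIntegral α φ x := by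
  rw [testOperator_apply, inner_add_left, real_inner_smul_left, real_inner_smul_left,
    inner_testDeriv, inner_fracToLp]
  ring

/-- The fundamental lemma of the calculus of variations; it makes `A_ε` single-valued. -/
theorem eq_zero_of_inner_testToLp {w : H} (h : ∀ φ, inner ℝ w (testToLp φ) = 0) : w = 0 := by
  have hw : Integrable (w : ℝ → ℝ) μΩ := (Lp.memLp w).integrable (by norm_num)
  have h1 : ∀ᵐ x ∂μΩ, x ∈ Ω → (w : ℝ → ℝ) x = 0 := by
    refine isOpen_Ioo.ae_eq_zero_of_integral_contDiff_smul_eq_zero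
      (hw.locallyIntegrable.locallyIntegrableOn _) fun φ h1 h2 h3 => ?_
    have h4 := h ⟨φ, h1, h2, h3⟩
    rw [real_inner_comm, inner_eq_of_ae (coeFn_testToLp _) (Filter.EventuallyEq.refl _ _)] at h4
    exact h4
  refine Lp.ext ?_
  filter_upwards [h1, ae_restrict_mem measurableSet_Ω, Lp.coeFn_zero ℝ 2 μΩ] with x h2 h3 h4
  rw [h2 h3, h4]; rfl

theorem exists_isEllipticForm {ε : ℝ} (hε : 0 < ε) (h₀ : 0 < α) (h₂ : α < 2) :
    ∃ C, IsEllipticForm testToLp (testToLp ∘ₗ testDeriv) (testOperator ε h₀ h₂) ε C := by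
  obtain ⟨C, hC0, hC⟩ := exists_integral_mul_fracIntegral_le h₀ h₂
  have hc := fracConst_nonneg h₀ h₂
  refine ⟨ε + fracConst α * C, hε, fun φ ψ => ?_, fun φ => ?_, fun φ => ?_,
    fun w => eq_zero_of_inner_testToLp⟩
  · rw [real_inner_comm (testOperator ε h₀ h₂ ψ), inner_testOperator, inner_testOperator,
      real_inner_comm, integral_mul_fracIntegral_comm h₀ h₂ φ.2.smooth φ.2.compactSupport
        ψ.2.smooth ψ.2.compactSupport]
  · rw [inner_testOperator, real_inner_self_eq_norm_sq, LinearMap.comp_apply]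
    have := mul_nonneg hc
      (integral_mul_fracIntegral_nonneg h₀ h₂ φ.2.smooth φ.2.compactSupport)
    linarith
  · rw [inner_testOperator, real_inner_self_eq_norm_sq, LinearMap.comp_apply]
    have h1 := hC φ φ.2.smooth φ.2.compactSupport
    rw [← norm_sq_testToLp, ← testDeriv_apply, ← norm_sq_testToLp] at h1
    have h3 := mul_le_mul_of_nonneg_left h1 hc
    nlinarith [sq_nonneg ‖testToLp φ‖]

theorem isAeps_iff_friedrichs (ε : ℝ) (h₀ : 0 < α) (h₂ : α < 2) (u w : H) :
    IsAeps ε α u w ↔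
      friedrichs testToLp (testToLp ∘ₗ testDeriv) (testOperator ε h₀ h₂) u w := by
  have hset : {q : H × H | ∃ φ : ℝ → ℝ, IsTestFunction φ ∧
      (q.1 : ℝ → ℝ) =ᵐ[μΩ] φ ∧ (q.2 : ℝ → ℝ) =ᵐ[μΩ] deriv φ} =
      range fun φ => (testToLp φ, (testToLp ∘ₗ testDeriv) φ) := by
    ext q
    constructor
    · rintro ⟨φ, hφ, h1, h2⟩
      refine ⟨⟨φ, hφ⟩, Prod.ext (Lp.ext ?_) (Lp.ext ?_)⟩
      · exact (coeFn_testToLp _).trans h1.symm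
      · exact (coeFn_testToLp _).trans h2.symm
    · rintro ⟨φ, rfl⟩
      exact ⟨φ, φ.2, coeFn_testToLp φ, coeFn_testToLp (testDeriv φ)⟩
  refine and_congr ?_ ⟨fun h φ => ?_, fun h φ hφ => ?_⟩
  · change (∃ u', (u, u') ∈ closure _) ↔ _
    rw [hset]
  · rw [inner_eq_of_ae (Filter.EventuallyEq.refl _ _) (coeFn_testOperator ε h₀ h₂ φ),
      inner_eq_of_ae (Filter.EventuallyEq.refl _ _) (coeFn_testToLp φ)]
    exact h φ φ.2
  · have := h ⟨φ, hφ⟩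
    rwa [inner_eq_of_ae (Filter.EventuallyEq.refl _ _) (coeFn_testOperator ε h₀ h₂ _),
      inner_eq_of_ae (Filter.EventuallyEq.refl _ _) (coeFn_testToLp _)] at this

theorem isPosSelfAdjoint_isAeps {ε : ℝ} (hε : 0 < ε) (h₀ : 0 < α) (h₂ : α < 2) :
    IsPosSelfAdjoint (IsAeps ε α) := by
  obtain ⟨C, hC⟩ := exists_isEllipticForm hε h₀ h₂
  have h : IsAeps ε α = friedrichs testToLp (testToLp ∘ₗ testDeriv) (testOperator ε h₀ h₂) := by
    ext u w
    exact isAeps_iff_friedrichs ε h₀ h₂ u w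
  rw [h]
  exact hC.isPosSelfAdjoint

end Operator

/-! ### Lipschitz continuity of the superposition operator -/

section Nemytskii

variable {f : ℝ → ℝ}

/-- If the superposition operator of `f` on `L²(Ω)` is Lipschitz near `0`, then `f` is globally
Lipschitz: test with constants times indicators of small sets. -/
theorem exists_lipschitzWith (hf : ∀ u : H, MemLp (fun x => f (u x)) 2 μΩ)
    (hL : LocallyLipschitz (nemytskii f hf)) : ∃ K, LipschitzWith K f := by
  obtain ⟨K, t, ht, hK⟩ := hL 0
  obtain ⟨r, hr, hrt⟩ := Metric.mem_nhds_iff.1 ht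
  refine ⟨K, LipschitzWith.of_dist_le_mul fun a b => ?_⟩
  -- The measure `η` is chosen after `a` and `b`, so that both constants times the indicator of `(0,
  -- η)`, of norms `|a| √η` and `|b| √η`, lie in the ball where the fixed constant `K` is valid.
  obtain ⟨η, hη0, hη1, hηr⟩ : ∃ η : ℝ, 0 < η ∧ η < Real.pi ∧ (|a| + |b| + 1) * √η < r := by
    have h1 : Tendsto (fun η : ℝ => (|a| + |b| + 1) * √η) (𝓝[>] 0) (𝓝 0) := by
      have : Continuous fun η : ℝ => (|a| + |b| + 1) * √η := by fun_prop
      simpa using (this.tendsto 0).mono_left nhdsWithin_le_nhds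
    have h2 := h1.eventually (gt_mem_nhds hr)
    have h3 : ∀ᶠ η in 𝓝[>] (0 : ℝ), η < Real.pi :=
      mem_nhdsWithin_of_mem_nhds (gt_mem_nhds Real.pi_pos)
    obtain ⟨η, h4, h5, h6⟩ := ((eventually_mem_nhdsWithin (a := (0 : ℝ)) (s := Ioi 0)).and (h3.and h2)).exists
    exact ⟨η, h4, h5, h6⟩
  set E : Set ℝ := Ioo 0 η
  have hE : MeasurableSet E := measurableSet_Ioo
  have hEΩ : E ⊆ Ω := fun x hx => ⟨by linarith [hx.1, Real.pi_pos], hx.2.trans hη1⟩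
  have hμ : μΩ E = ENNReal.ofReal η := by
    rw [μΩ, Measure.restrict_apply hE, inter_eq_self_of_subset_left hEΩ, Real.volume_Ioo, sub_zero]
  have hμ' : μΩ E ≠ ⊤ := by rw [hμ]; exact ENNReal.ofReal_ne_top
  let v : ℝ → H := fun c => indicatorConstLp 2 hE hμ' c
  have hnorm : ∀ c, ‖v c‖ = |c| * √η := fun c => by
    rw [norm_indicatorConstLp (by norm_num) (by norm_num), Measure.real, hμ,
      ENNReal.toReal_ofReal hη0.le, Real.sqrt_eq_rpow, Real.norm_eq_abs]
    norm_num
  have hmem : ∀ c, |c| ≤ |a| + |b| → v c ∈ t := fun c hc => hrt (by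
    rw [mem_ball_zero_iff, hnorm]
    refine lt_of_le_of_lt (mul_le_mul_of_nonneg_right ?_ (Real.sqrt_nonneg η)) hηr
    linarith)
  have h1 := hK.dist_le_mul (v a) (hmem a (by linarith [abs_nonneg b])) (v b)
    (hmem b (by linarith [abs_nonneg a]))
  have h2 : v a - v b = v (a - b) := by
    refine Lp.ext ?_
    filter_upwards [Lp.coeFn_sub (v a) (v b), indicatorConstLp_coeFn (p := 2) (hs := hE)
      (hμs := hμ') (c := a), indicatorConstLp_coeFn (p := 2) (hs := hE) (hμs := hμ') (c := b),
      indicatorConstLp_coeFn (p := 2) (hs := hE) (hμs := hμ') (c := a - b)] with x k1 k2 k3 k4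
    rw [k1, Pi.sub_apply, k2, k3, k4]
    by_cases hx : x ∈ E <;> simp [hx]
  -- Off `E` both images equal `f 0`, which cancels; both sides of the Lipschitz bound then carry
  -- the factor `√η`.
  have h3 : nemytskii f hf (v a) - nemytskii f hf (v b) = v (f a - f b) := by
    refine Lp.ext ?_
    filter_upwards [Lp.coeFn_sub (nemytskii f hf (v a)) (nemytskii f hf (v b)),
      (hf (v a)).coeFn_toLp, (hf (v b)).coeFn_toLp, indicatorConstLp_coeFn (p := 2) (hs := hE)
      (hμs := hμ') (c := a), indicatorConstLp_coeFn (p := 2) (hs := hE) (hμs := hμ') (c := b),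
      indicatorConstLp_coeFn (p := 2) (hs := hE) (hμs := hμ') (c := f a - f b)]
      with x k1 k5 k6 k2 k3 k4
    rw [k1, Pi.sub_apply, k4, nemytskii, nemytskii, k5, k6, k2, k3]
    by_cases hx : x ∈ E <;> simp [hx]
  rw [dist_eq_norm, dist_eq_norm, h2, h3, hnorm, hnorm, ← mul_assoc] at h1
  exact le_of_mul_le_mul_right h1 (Real.sqrt_pos.2 hη0)

theorem lipschitzWith_nemytskii (hf : ∀ u : H, MemLp (fun x => f (u x)) 2 μΩ) {K : NNReal}
    (hK : LipschitzWith K f) : LipschitzWith K (nemytskii f hf) := by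
  refine LipschitzWith.of_dist_le_mul fun u v => ?_
  rw [dist_eq_norm, dist_eq_norm]
  refine Lp.norm_le_mul_norm_of_ae_le_mul ?_
  filter_upwards [Lp.coeFn_sub (nemytskii f hf u) (nemytskii f hf v), Lp.coeFn_sub u v,
    (hf u).coeFn_toLp, (hf v).coeFn_toLp] with x h1 h2 h3 h4
  rw [h1, h2, Pi.sub_apply, Pi.sub_apply, nemytskii, nemytskii, h3, h4]
  exact hK.norm_sub_le _ _

end Nemytskii

/-! ### Equivalence of weak solutions and the variation-of-constants formula -/

section Solutions

variable {A : H → H → Prop} {S : ℝ → H →L[ℝ] H} {F : H → H}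

theorem IsContractionSemigroup.isExpNeg (hA : IsPosSelfAdjoint A)
    (hS : IsContractionSemigroup A S) : IsExpNeg A S :=
  ⟨⟨hS.zero, hS.add, fun x => (hS.continuous_apply x).continuousOn⟩, hS.generator_iff hA⟩

theorem IsContractionSemigroup.isSolutionOn_of_variationOfConstants
    (hS : IsContractionSemigroup A S) (hF : Continuous F) {g u₀ : H} {u : ℝ → H}
    (hu : Continuous u) (h : ∀ t, 0 ≤ t → VariationOfConstants S F g u₀ u t) (T : ℝ) :
    IsSolutionOn A F g u₀ T u := by
  have hmild : ∀ t, 0 ≤ t → u t = S t u₀ + ∫ s in (0 : ℝ)..t, S (t - s) (g - F (u s)) := by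
    intro t ht
    rw [h t ht, sub_eq_add_neg, ← intervalIntegral.integral_neg]
    simp only [← map_neg, neg_sub]
  refine ⟨hu.continuousOn, ?_, fun φ ψ hφ t ht => ?_⟩
  · rw [hmild 0 le_rfl, hS.zero]; simp
  · have h1 := hS.weak_of_mild (h := fun s => g - F (u s))
      (continuous_const.sub (hF.comp hu)) u₀ hφ ht.1
    rw [hmild t ht.1, h1]
    congr 1
    refine intervalIntegral.integral_congr fun s hs => ?_
    rw [uIcc_of_le ht.1] at hs
    rw [← hmild s hs.1, inner_sub_left]
    ring

theorem IsSolutionOn.variationOfConstants (hA : IsPosSelfAdjoint A)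
    (hS : IsContractionSemigroup A S) (hF : Continuous F) {g u₀ : H} {T : ℝ} (hT : 0 < T)
    {v : ℝ → H} (hv : IsSolutionOn A F g u₀ T v) :
    ∀ t ∈ Icc 0 T, VariationOfConstants S F g u₀ v t := by
  -- The linear theory is stated for functions continuous on all of `ℝ`; extending `v` by its
  -- endpoint values changes nothing on `[0, T]`.
  set v' : ℝ → H := IccExtend hT.le ((Icc 0 T).domRestrict v) with hv'
  have hc : Continuous v' := (continuousOn_iff_continuous_domRestrict.1 hv.continuousOn).Icc_extend'
  have he : ∀ t ∈ Icc 0 T, v' t = v t := fun t ht => by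
    rw [hv', IccExtend_of_mem hT.le _ ht, domRestrict_apply]
  have hmild := hS.mild_of_weak hA (T := T) (h := fun s => g - F (v' s)) hc
    (continuous_const.sub (hF.comp hc)) u₀ (fun φ ψ hφ t ht => by
      rw [he t ht, hv.equation φ ψ hφ t ht]
      congr 1
      refine intervalIntegral.integral_congr fun s hs => ?_
      rw [uIcc_of_le ht.1] at hs
      rw [he s ⟨hs.1, hs.2.trans ht.2⟩, inner_sub_left]
      ring)
  intro t ht
  rw [VariationOfConstants, ← he t ht, hmild t ht, sub_eq_add_neg, ← intervalIntegral.integral_neg]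
  congr 1
  refine intervalIntegral.integral_congr fun s hs => ?_
  rw [uIcc_of_le ht.1] at hs
  rw [he s ⟨hs.1, hs.2.trans ht.2⟩, ← map_neg, neg_sub]

end Solutions

end AnomalousDiffusion

theorem theorem3p1 (α ε : ℝ) (hα₀ : 0 < α) (hα₂ : α < 2) (hε : 0 < ε)
    (f : ℝ → ℝ)
    (hfH : ∀ u : AnomalousDiffusion.H,
      MemLp (fun x => f (u x)) 2 AnomalousDiffusion.μΩ)
    (hfLip : LocallyLipschitz (AnomalousDiffusion.nemytskii f hfH))
    (p : ℝ) (hp : 2 ≤ p) (hf : AnomalousDiffusion.GrowthCondition f p)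
    (g : AnomalousDiffusion.H) :
    ∃ S : ℝ → AnomalousDiffusion.H →L[ℝ] AnomalousDiffusion.H,
      AnomalousDiffusion.IsExpNeg (AnomalousDiffusion.IsAeps ε α) S ∧
      ∀ u₀ : AnomalousDiffusion.H, ∃ u : ℝ → AnomalousDiffusion.H,
        ContinuousOn u (Ici 0) ∧
        (∀ T : ℝ, 0 < T → AnomalousDiffusion.IsSolutionOn (AnomalousDiffusion.IsAeps ε α)
          (AnomalousDiffusion.nemytskii f hfH) g u₀ T u) ∧
        (∀ t : ℝ, 0 ≤ t → AnomalousDiffusion.VariationOfConstants S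
          (AnomalousDiffusion.nemytskii f hfH) g u₀ u t) ∧
        ∀ T : ℝ, 0 < T → ∀ v : ℝ → AnomalousDiffusion.H, ContinuousOn v (Icc 0 T) →
          (AnomalousDiffusion.IsSolutionOn (AnomalousDiffusion.IsAeps ε α)
              (AnomalousDiffusion.nemytskii f hfH) g u₀ T v ∨
            ∀ t ∈ Icc 0 T, AnomalousDiffusion.VariationOfConstants S
              (AnomalousDiffusion.nemytskii f hfH) g u₀ v t) →
          EqOn v u (Icc 0 T) := by
  have hA := AnomalousDiffusion.isPosSelfAdjoint_isAeps hε hα₀ hα₂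
  obtain ⟨S, hS⟩ := hA.exists_semigroup
  obtain ⟨K, hK⟩ := AnomalousDiffusion.exists_lipschitzWith hfH hfLip
  have hF := AnomalousDiffusion.lipschitzWith_nemytskii hfH hK
  refine ⟨S, hS.isExpNeg hA, fun u₀ => ?_⟩
  obtain ⟨u, hu, hmild⟩ := hS.exists_mild hF g u₀
  refine ⟨u, hu.continuousOn, fun T _ =>
    hS.isSolutionOn_of_variationOfConstants hF.continuous hu hmild T, hmild, ?_⟩
  intro T hT v hv h
  have hv' : ∀ t ∈ Icc 0 T, AnomalousDiffusion.VariationOfConstants S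
      (AnomalousDiffusion.nemytskii f hfH) g u₀ v t :=
    h.elim (fun h => h.variationOfConstants hA hS hF.continuous hT) id
  exact hS.mild_unique hF hv hu.continuousOn hv' fun t ht => hmild t ht.1
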